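/- **Setting.** Let $(H_i,Z_i,X_i)_{i\ge 1}$ be i.i.d. triples on a probability space, with $H_i\in\{0,1\}$ ($H_i=0$ means that hypothesis $i$ is a true null), $Z_i\in\mathbb R$ and $X_i\in\mathbb R^p$. Given $H_i=0$ and $X_i$, $Z_i$ is $\mathcal N(0,1)$; given $H_i=1$ and $X_i=x$, $Z_i$ has a density $f_{1,x}$. Put $U_i=\Phi(Z_i)$, where $\Phi$ is the standard normal distribution function. Fix $\alpha\in(0,1)$ and $\gamma_l,\gamma_r>2$. **Working model (possibly misspecified).** For $\theta=(\theta_l,\theta_r)$ and $\beta=(\beta_l,\beta_r)$ with $\theta_l,\theta_r,\beta_l,\beta_r\in\mathbb R^{p+1}$, and with $\tilde x=(1,x^T)^T$, let $$\pi_{l,x}=\frac{e^{\tilde x^T\theta_l}}{1+e^{\tilde x^T\theta_r}+e^{\tilde x^T\theta_l}},\quad \pi_{r,x}=\frac{e^{\tilde x^T\theta_r}}{1+e^{\tilde x^T\theta_r}+e^{\tilde x^T\theta_l}},\quad k_{l,x}=\frac1{1+e^{-\tilde x^T\beta_l}},\quad k_{r,x}=\frac1{1+e^{-\tilde x^T\beta_r}}.$$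 Let $h_{l,x}$ be the $\mathrm{Beta}(k_{l,x},\gamma_l)$ density and $h_{r,x}$ the $\mathrm{Beta}(\gamma_r,k_{r,x})$ density, and for $u\in(0,1)$ let $$h_x(u)=1-\pi_{l,x}-\pi_{r,x}+\pi_{l,x}h_{l,x}(u)+\pi_{r,x}h_{r,x}(u),\qquad a_x(u)=\frac{1-\pi_{l,x}-\pi_{r,x}}{h_x(u)}$$ ($a_x$ is the assessor). Let $c_x(t)$ be the probability that $a_x(V)\le t$ for $V\sim\mathrm{Unif}(0,1)$, and $c_x^{-1}(s)=\inf\{t\in[0,1]:c_x(t)\ge s\}$. **Procedure.** Let $\Theta,\boldsymbol B\subset\mathbb R^{2(p+1)}$. For every $m$ let $(\hat\theta,\hat\beta)$ be a (measurable) maximizer of $\sum_{i=1}^m\log h_{X_i}(U_i)$ over $\Theta\times\boldsymbol B$, and let $\hat a_x,\hat c_x$ be $a_x,c_x$ at $(\hat\theta,\hat\beta)$. Put $\hat T_i=\hat a_{X_i}(U_i)$, $\hat c_i=\hat c_{X_i}$, $\hat S_i=\hat c_i(\hat T_i)$, $\hat T_i^{\mathfrak m}=\hat c_i^{-1}(1-\hat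 S_i)$, and $$\widehat{\mathrm{FDP}}(t)=\frac{1+\#\{i\le m:\hat T_i^{\mathfrak m}\le t\}}{\#\{i\le m:\hat T_i\le t\}\vee 1},\qquad \hat t(\alpha)=\sup\{t\in[0,1]:\widehat{\mathrm{FDP}}(t)\le\alpha\}$$ (with $\hat t(\alpha)=0$ if this set is empty). Asymptotic ZAP rejects hypothesis $i\le m$ iff $\hat T_i\le\hat t(\alpha)$. With $R$ the number of rejections and $V$ the number of rejected $i$ with $H_i=0$, $\mathrm{FDR}_m=\mathbb E[V/(R\vee1)]$. **Assumptions.** 1. $\Theta$ and $\boldsymbol B$ are compact, and the expected log-likelihood $\mathbb E\log h_{X_1}(U_1)$ (under the true law) has a unique maximizer $(\theta^*,\beta^*)$ over $\Theta\times\boldsymbol B$. 2. (i) For some constant $C$, almost surely $\|X_i\|_\infty\le C$ for all $i$. (ii) For all $0<\delta_1<\delta_2<1$ there is a constant $C(\delta_1,\delta_2)$ such that for all sequences of measurable sets $V_{1i},V_{2i}\subset(\delta_1,\delta_2)$, almost surely, for all large enough $m$, $$\Bigl|\tfrac1m\sum_{i=1}^m\bigl(P(U_i\in V_{1i}\mid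 X_i)-P(U_i\in V_{2i}\mid X_i)\bigr)\Bigr|\le C(\delta_1,\delta_2)\max_{1\le i\le m}\lambda(V_{1i}\,\triangle\,V_{2i}),$$ where $\lambda$ is Lebesgue measure. (iii) $\log U_1$ and $\log(1-U_1)$ are integrable. 3. $\pi_0=P(H_1=0)>0$. Let $c_i^*$, $T_i^*$, $S_i^*$ be $c_{X_i}$, $a_{X_i}(U_i)$ and $c_{X_i}(a_{X_i}(U_i))$ at $(\theta^*,\beta^*)$. For every $t\in(0,1]$, almost surely as $m\to\infty$, $$\tfrac1m\sum_{i\le m}I(T_i^*\le t)\to G(t),\quad \tfrac1m\sum_{i\le m}(1-H_i)I(T_i^*\le t)\to\pi_0G_0(t),\quad \tfrac1m\sum_{i\le m}I(S_i^*\ge1-c_i^*(t))\to\bar G_0(t),$$ with $G,G_0,\bar G_0$ positive and continuous on $(0,1]$. Moreover $\bar G_0(t_0)/G(t_0)<\alpha$ for some $t_0\in(0,1]$, and with $t_\alpha^\infty=\sup\{t\in(0,1]:\bar G_0(t)/G(t)\le\alpha\}$ there is $\bar s<1$ such that almost surely $c_i^*(t_\alpha^\infty)<\bar s$ for all $i$.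 **Theorem.** Under these assumptions the false discovery proportion $V/(R\vee1)$ is integrable for every $m$, and $$\limsup_{m\to\infty}\mathrm{FDR}_m\le\alpha .$$ -/

import Mathlib

open MeasureTheory ProbabilityTheory Filter Topology
open scoped ENNReal

noncomputable section

namespace ZAP

/-! ## The beta-mixture working model -/

/-- Coefficient vectors for the intercept-augmented covariate `(1, x) ∈ ℝ^{p+1}`. -/
abbrev Coef (p : ℕ) : Type := Fin (p + 1) → ℝ

/-- A parameter of the working model: `ξ.1 = θ = (θ_l, θ_r)` and `ξ.2 = β = (β_l, β_r)`. -/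
abbrev Param (p : ℕ) : Type := (Coef p × Coef p) × (Coef p × Coef p)

/-- The linear predictor `x̃ᵀ b` with `x̃ = (1, x)`. -/
def linPred {p : ℕ} (x : Fin p → ℝ) (b : Coef p) : ℝ :=
  Matrix.vecCons 1 x ⬝ᵥ b

/-- The mixing probability `π_{l,x}`. -/
def piL {p : ℕ} (θ : Coef p × Coef p) (x : Fin p → ℝ) : ℝ :=
  Real.exp (linPred x θ.1) / (1 + Real.exp (linPred x θ.2) + Real.exp (linPred x θ.1))

/-- The mixing probability `π_{r,x}`. -/
def piR {p : ℕ} (θ : Coef p × Coef p) (x : Fin p → ℝ) : ℝ :=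
  Real.exp (linPred x θ.2) / (1 + Real.exp (linPred x θ.2) + Real.exp (linPred x θ.1))

/-- The logistic shape parameter `k = 1 / (1 + exp (- x̃ᵀ b))`. -/
def shape {p : ℕ} (b : Coef p) (x : Fin p → ℝ) : ℝ :=
  (1 + Real.exp (-linPred x b))⁻¹

/-- The left non-null component `h_{l,x}`: the `Beta(k_{l,x}, γ_l)` density. -/
def hL {p : ℕ} (γl : ℝ) (β : Coef p × Coef p) (x : Fin p → ℝ) (u : ℝ) : ℝ :=
  betaPDFReal (shape β.1 x) γl u

/-- The right non-null component `h_{r,x}`: the `Beta(γ_r, k_{r,x})` density. -/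
def hR {p : ℕ} (γr : ℝ) (β : Coef p × Coef p) (x : Fin p → ℝ) (u : ℝ) : ℝ :=
  betaPDFReal γr (shape β.2 x) u

/-- The working-model density `h_x(u)` on `(0,1)` (the null component is uniform). -/
def mixDensity {p : ℕ} (γl γr : ℝ) (ξ : Param p) (x : Fin p → ℝ) (u : ℝ) : ℝ :=
  (1 - piL ξ.1 x - piR ξ.1 x) + piL ξ.1 x * hL γl ξ.2 x u + piR ξ.1 x * hR γr ξ.2 x u

/-- The assessor `a_x(u)`. -/
def assessor {p : ℕ} (γl γr : ℝ) (ξ : Param p) (x : Fin p → ℝ) (u : ℝ) : ℝ :=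
  (1 - piL ξ.1 x - piR ξ.1 x) / mixDensity γl γr ξ x u

/-- The null distribution function `c_x(t)` of the assessor: the probability that
`a_x(V) ≤ t` for `V` uniform on `(0,1)`, the assessor being treated as fixed. -/
def nullCDF {p : ℕ} (γl γr : ℝ) (ξ : Param p) (x : Fin p → ℝ) (t : ℝ) : ℝ :=
  (volume.restrict (Set.Ioo (0 : ℝ) 1)).real {u | assessor γl γr ξ x u ≤ t}

/-- The inverse `c_x⁻¹` of the null distribution function, as a quantile function on `[0,1]`. -/
def nullQuantile {p : ℕ} (γl γr : ℝ) (ξ : Param p) (x : Fin p → ℝ) (s : ℝ) : ℝ :=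
  sInf {t : ℝ | t ∈ Set.Icc (0 : ℝ) 1 ∧ s ≤ nullCDF γl γr ξ x t}

/-- `S = c_x(T)` with `T = a_x(u)`. -/
def sStat {p : ℕ} (γl γr : ℝ) (ξ : Param p) (x : Fin p → ℝ) (u : ℝ) : ℝ :=
  nullCDF γl γr ξ x (assessor γl γr ξ x u)

/-- The mirror statistic `c_x⁻¹(1 - S)`. -/
def mirror {p : ℕ} (γl γr : ℝ) (ξ : Param p) (x : Fin p → ℝ) (u : ℝ) : ℝ :=
  nullQuantile γl γr ξ x (1 - sStat γl γr ξ x u)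

/-! ## The testing procedure

For covariates `x i`, `u`-values `u i` and an (estimated) parameter `ξ`; the `m` hypotheses are
those with index in `Finset.range m`. -/

/-- The log-likelihood of the first `m` observations in the working model. -/
def logLik {p : ℕ} (γl γr : ℝ) (x : ℕ → Fin p → ℝ) (u : ℕ → ℝ) (m : ℕ) (ξ : Param p) : ℝ :=
  ∑ i ∈ Finset.range m, Real.log (mixDensity γl γr ξ (x i) (u i))

/-- The estimated false discovery proportion at the candidate threshold `t`. -/
def fdpHat {p : ℕ} (γl γr : ℝ) (ξ : Param p) (x : ℕ → Fin p → ℝ) (u : ℕ → ℝ) (m : ℕ)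
    (t : ℝ) : ℝ :=
  (1 + (((Finset.range m).filter fun i => mirror γl γr ξ (x i) (u i) ≤ t).card : ℝ)) /
    (max ((Finset.range m).filter fun i => assessor γl γr ξ (x i) (u i) ≤ t).card 1 : ℕ)

/-- The data-driven threshold `sup {0 ≤ t ≤ 1 : FDPhat(t) ≤ α}`. If no `t` qualifies it is `0`,
and then nothing is rejected, as the assessor is positive on `(0,1)`. -/
def threshold {p : ℕ} (γl γr α : ℝ) (ξ : Param p) (x : ℕ → Fin p → ℝ) (u : ℕ → ℝ)
    (m : ℕ) : ℝ :=
  sSup {t : ℝ | t ∈ Set.Icc (0 : ℝ) 1 ∧ fdpHat γl γr ξ x u m t ≤ α}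

/-- The set of rejected hypotheses. -/
def rejected {p : ℕ} (γl γr α : ℝ) (ξ : Param p) (x : ℕ → Fin p → ℝ) (u : ℕ → ℝ)
    (m : ℕ) : Finset ℕ :=
  (Finset.range m).filter fun i => assessor γl γr ξ (x i) (u i) ≤ threshold γl γr α ξ x u m

/-- The false discovery proportion `V / (R ∨ 1)` of a rejection set `R`, where `h i = true`
means that hypothesis `i` is non-null. -/
def fdp (h : ℕ → Bool) (R : Finset ℕ) : ℝ :=
  ((R.filter fun i => h i = false).card : ℝ) / (max R.card 1 : ℕ)

/-! ## The data-generating model and the assumptions -/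

/-- The `u`-value `Φ(z)`, with `Φ` the standard normal distribution function. -/
def uValue (z : ℝ) : ℝ := cdf (gaussianReal 0 1) z

/-- The triples `(H i, Z i, X i)` are i.i.d.; given a true null (`H i = false`) and the covariate,
`Z i` is standard normal; given a non-null (`H i = true`) and `X i = x`, `Z i` has a
density `f₁ x`. The last two conditions are stated through the joint law. -/
structure TwoGroupModel {Ω : Type*} [MeasurableSpace Ω] (P : Measure Ω) {p : ℕ}
    (H : ℕ → Ω → Bool) (Z : ℕ → Ω → ℝ) (X : ℕ → Ω → Fin p → ℝ) : Prop where
  measurable_H : ∀ i, Measurable (H i)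
  measurable_Z : ∀ i, Measurable (Z i)
  measurable_X : ∀ i, Measurable (X i)
  indep : iIndepFun (fun i ω => (H i ω, Z i ω, X i ω)) P
  identDistrib : ∀ i, IdentDistrib (fun ω => (H i ω, Z i ω, X i ω))
    (fun ω => (H 0 ω, Z 0 ω, X 0 ω)) P P
  null_law : ∀ (i : ℕ) (A : Set ℝ) (B : Set (Fin p → ℝ)), MeasurableSet A → MeasurableSet B →
    P {ω | H i ω = false ∧ Z i ω ∈ A ∧ X i ω ∈ B} =
      P {ω | H i ω = false ∧ X i ω ∈ B} * gaussianReal 0 1 A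
  alternative_law : ∃ f₁ : (Fin p → ℝ) → ℝ → ℝ≥0∞, Measurable (Function.uncurry f₁) ∧
    (∀ x, ∫⁻ z, f₁ x z = 1) ∧
    ∀ (i : ℕ) (A : Set ℝ) (B : Set (Fin p → ℝ)), MeasurableSet A → MeasurableSet B →
      P {ω | H i ω = true ∧ Z i ω ∈ A ∧ X i ω ∈ B} =
        ∫⁻ ω in {ω | H i ω = true ∧ X i ω ∈ B}, (∫⁻ z in A, f₁ (X i ω) z) ∂P

/-- The expected log-likelihood `E log h_X(U)` of the working model under the true law. -/
def expLogLik {Ω : Type*} [MeasurableSpace Ω] (P : Measure Ω) {p : ℕ} (γl γr : ℝ)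
    (Z : ℕ → Ω → ℝ) (X : ℕ → Ω → Fin p → ℝ) (ξ : Param p) : ℝ :=
  ∫ ω, Real.log (mixDensity γl γr ξ (X 0 ω) (uValue (Z 0 ω))) ∂P

/-- `ξ` is the unique maximizer of the expected log-likelihood over the compact set `Θ × B`. -/
structure UniqueMaximizer {Ω : Type*} [MeasurableSpace Ω] (P : Measure Ω) {p : ℕ} (γl γr : ℝ)
    (Z : ℕ → Ω → ℝ) (X : ℕ → Ω → Fin p → ℝ) (Θ B : Set (Coef p × Coef p))
    (ξ : Param p) : Prop where
  compact_theta : IsCompact Θ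
  compact_beta : IsCompact B
  mem : ξ ∈ Θ ×ˢ B
  lt_max : ∀ η ∈ Θ ×ˢ B, η ≠ ξ → expLogLik P γl γr Z X η < expLogLik P γl γr Z X ξ

/-- Regularity of the tails of the covariates and of the `u`-values. The norm on `Fin p → ℝ` is
the sup norm. -/
structure Regularity {Ω : Type*} [MeasurableSpace Ω] (P : Measure Ω) {p : ℕ}
    (Z : ℕ → Ω → ℝ) (X : ℕ → Ω → Fin p → ℝ) : Prop where
  bounded : ∃ C : ℝ, ∀ᵐ ω ∂P, ∀ i, ‖X i ω‖ ≤ C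
  conditional : ∀ δ₁ δ₂ : ℝ, 0 < δ₁ → δ₁ < δ₂ → δ₂ < 1 → ∃ C : ℝ,
    ∀ V₁ V₂ : ℕ → Set ℝ,
      (∀ i, MeasurableSet (V₁ i) ∧ V₁ i ⊆ Set.Ioo δ₁ δ₂) →
      (∀ i, MeasurableSet (V₂ i) ∧ V₂ i ⊆ Set.Ioo δ₁ δ₂) →
      ∀ᵐ ω ∂P, ∀ᶠ m : ℕ in atTop,
        |(1 / (m : ℝ)) * ∑ i ∈ Finset.range m,
            ((P⟦{ω' | uValue (Z i ω') ∈ V₁ i} | MeasurableSpace.comap (X i) inferInstance⟧) ω -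
             (P⟦{ω' | uValue (Z i ω') ∈ V₂ i} | MeasurableSpace.comap (X i) inferInstance⟧) ω)|
          ≤ C * ⨆ i : Fin m, volume.real (symmDiff (V₁ i) (V₂ i))
  integrable_log : Integrable (fun ω => Real.log (uValue (Z 0 ω))) P
  integrable_log_one_sub : Integrable (fun ω => Real.log (1 - uValue (Z 0 ω))) P

/-- The limiting threshold `sup {t ∈ (0,1] : Ḡ₀(t) / G(t) ≤ α}`. -/
def limitThreshold (α : ℝ) (G Gbar₀ : ℝ → ℝ) : ℝ :=
  sSup {t : ℝ | t ∈ Set.Ioc (0 : ℝ) 1 ∧ Gbar₀ t / G t ≤ α}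

/-- Strong laws at the population parameter `ξ`, with limits `G`, `π₀ G₀` and `Gbar₀`, and the
conditions on these limits at the level `α`. -/
structure StrongLaws {Ω : Type*} [MeasurableSpace Ω] (P : Measure Ω) {p : ℕ} (γl γr α : ℝ)
    (H : ℕ → Ω → Bool) (Z : ℕ → Ω → ℝ) (X : ℕ → Ω → Fin p → ℝ) (ξ : Param p)
    (G G₀ Gbar₀ : ℝ → ℝ) : Prop where
  null_pos : 0 < P.real {ω | H 0 ω = false}
  tendsto_all : ∀ t ∈ Set.Ioc (0 : ℝ) 1, ∀ᵐ ω ∂P, Tendsto (fun m : ℕ =>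
    (((Finset.range m).filter fun i =>
      assessor γl γr ξ (X i ω) (uValue (Z i ω)) ≤ t).card : ℝ) / m) atTop (𝓝 (G t))
  tendsto_null : ∀ t ∈ Set.Ioc (0 : ℝ) 1, ∀ᵐ ω ∂P, Tendsto (fun m : ℕ =>
    (((Finset.range m).filter fun i => H i ω = false ∧
      assessor γl γr ξ (X i ω) (uValue (Z i ω)) ≤ t).card : ℝ) / m) atTop
    (𝓝 (P.real {ω | H 0 ω = false} * G₀ t))
  tendsto_mirror : ∀ t ∈ Set.Ioc (0 : ℝ) 1, ∀ᵐ ω ∂P, Tendsto (fun m : ℕ =>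
    (((Finset.range m).filter fun i =>
      1 - nullCDF γl γr ξ (X i ω) t ≤ sStat γl γr ξ (X i ω) (uValue (Z i ω))).card : ℝ) / m)
    atTop (𝓝 (Gbar₀ t))
  pos : ∀ t ∈ Set.Ioc (0 : ℝ) 1, 0 < G t ∧ 0 < G₀ t ∧ 0 < Gbar₀ t
  continuousOn_G : ContinuousOn G (Set.Ioc 0 1)
  continuousOn_G₀ : ContinuousOn G₀ (Set.Ioc 0 1)
  continuousOn_Gbar₀ : ContinuousOn Gbar₀ (Set.Ioc 0 1)
  exists_lt : ∃ t ∈ Set.Ioc (0 : ℝ) 1, Gbar₀ t / G t < α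
  limit_lt : ∃ sbar : ℝ, sbar < 1 ∧
    ∀ᵐ ω ∂P, ∀ i, nullCDF γl γr ξ (X i ω) (limitThreshold α G Gbar₀) < sbar

/-- `est m` is a (measurable) maximum likelihood estimator of the working model over `Θ × B` from
the first `m` observations, for every `m`. -/
structure IsMLE {Ω : Type*} [MeasurableSpace Ω] (P : Measure Ω) {p : ℕ} (γl γr : ℝ)
    (Z : ℕ → Ω → ℝ) (X : ℕ → Ω → Fin p → ℝ) (Θ B : Set (Coef p × Coef p))
    (est : ℕ → Ω → Param p) : Prop where
  measurable : ∀ m, Measurable (est m)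
  isMax : ∀ m, ∀ᵐ ω ∂P, est m ω ∈ Θ ×ˢ B ∧
    IsMaxOn (logLik γl γr (fun i => X i ω) (fun i => uValue (Z i ω)) m) (Θ ×ˢ B) (est m ω)

/-- The false discovery proportion of asymptotic ZAP on the first `m` hypotheses, with the assessor
built from the estimate `est m`. -/
def zapFDP {Ω : Type*} {p : ℕ} (γl γr α : ℝ) (H : ℕ → Ω → Bool) (Z : ℕ → Ω → ℝ)
    (X : ℕ → Ω → Fin p → ℝ) (est : ℕ → Ω → Param p) (m : ℕ) (ω : Ω) : ℝ :=
  fdp (fun i => H i ω)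
    (rejected γl γr α (est m ω) (fun i => X i ω) (fun i => uValue (Z i ω)) m)

end ZAP

end

noncomputable section

namespace ZAP

/-! ## Analysis of the working model -/

section Continuity

variable {Y : Type*} [TopologicalSpace Y] {p : ℕ}

/-! Under the null, `U` is uniform and independent of the covariate, so given `X = x` the event `T ≤
t` has probability `c_x(t)`. Since `S = c_x(T)` is then uniform, the mirror event `S ≥ 1 - c_x(t)`
has the same probability. Both null counts, divided by `m`, therefore approach `D(t) = E[1{H = 0}
c_X(t)]` (`nullMass`). The mirror count over all hypotheses is at least the one over the nulls, so
up to `o(m)` it dominates the number of false discoveries, whether or not the working model is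
correct.

Two points turn this into a theorem. First, the assessor is estimated and the threshold depends on
the data, so the counts must be controlled uniformly in `t` at a random parameter. The maximum
likelihood estimator is consistent by a strong law in the Banach space of continuous functions on
the compact parameter set (`uniform_strong_law`, `tendsto_of_isMaxOn`, `exists_tendsto_eq_est`).
Indicators are replaced by continuous ramps, to which the same strong law applies with `t` as an
additional compact parameter (`eventually_ramp_mean`). This needs `c_x(t)` to be jointly continuous
in parameter, covariate and threshold (`continuous_nullCDF`), which follows from strict convexity of
the mixture density: level sets of the assessor are finite.

Second, the number of rejections must grow linearly. At a point `t₀` with `Ḡ₀(t₀)/G(t₀) < α` the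
estimated proportion is eventually at most `α`, so the threshold is at least `t₀` and at least `m
G(t₀)/2` hypotheses are rejected. Then `fdp_rejected_le` bounds the false discovery proportion by `α
+ η` almost surely, eventually, for each `η > 0`, and dominated convergence passes to expectations
(`limsup_integral_le`). -/

theorem continuous_linPred {x : Y → Fin p → ℝ} {b : Y → Coef p} (hx : Continuous x)
    (hb : Continuous b) : Continuous fun y => linPred (x y) (b y) := by
  unfold linPred
  simp only [dotProduct, Fin.sum_univ_succ, Matrix.cons_val_zero, Matrix.cons_val_succ]
  fun_prop

theorem denom_pos (a b : ℝ) : 0 < 1 + Real.exp a + Real.exp b := by positivity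

theorem continuous_piL {θ : Y → Coef p × Coef p} {x : Y → Fin p → ℝ} (hθ : Continuous θ)
    (hx : Continuous x) : Continuous fun y => piL (θ y) (x y) := by
  have h1 := continuous_linPred hx hθ.fst
  have h2 := continuous_linPred hx hθ.snd
  unfold piL
  exact h1.rexp.div (by fun_prop) fun y => (denom_pos _ _).ne'

theorem continuous_piR {θ : Y → Coef p × Coef p} {x : Y → Fin p → ℝ} (hθ : Continuous θ)
    (hx : Continuous x) : Continuous fun y => piR (θ y) (x y) := by
  have h1 := continuous_linPred hx hθ.fst
  have h2 := continuous_linPred hx hθ.snd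
  unfold piR
  exact h2.rexp.div (by fun_prop) fun y => (denom_pos _ _).ne'

theorem continuous_shape {b : Y → Coef p} {x : Y → Fin p → ℝ} (hb : Continuous b)
    (hx : Continuous x) : Continuous fun y => shape (b y) (x y) := by
  have h1 := continuous_linPred hx hb
  unfold shape
  exact Continuous.inv₀ (by fun_prop) fun y => by positivity

theorem piL_pos (θ : Coef p × Coef p) (x : Fin p → ℝ) : 0 < piL θ x := by
  unfold piL; positivity

theorem piR_pos (θ : Coef p × Coef p) (x : Fin p → ℝ) : 0 < piR θ x := by
  unfold piR; positivity

theorem piNull_pos (θ : Coef p × Coef p) (x : Fin p → ℝ) : 0 < 1 - piL θ x - piR θ x := by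
  have h := denom_pos (linPred x θ.2) (linPred x θ.1)
  have : 1 - piL θ x - piR θ x =
      1 / (1 + Real.exp (linPred x θ.2) + Real.exp (linPred x θ.1)) := by
    unfold piL piR; field_simp; ring
  rw [this]; positivity

theorem shape_pos (b : Coef p) (x : Fin p → ℝ) : 0 < shape b x := by
  unfold shape; positivity

theorem shape_lt_one (b : Coef p) (x : Fin p → ℝ) : shape b x < 1 := by
  unfold shape
  exact inv_lt_one_of_one_lt₀ (by linarith [Real.exp_pos (-linPred x b)])

theorem continuous_beta {a b : Y → ℝ} (ha : Continuous a) (hb : Continuous b)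
    (ha0 : ∀ y, 0 < a y) (hb0 : ∀ y, 0 < b y) : Continuous fun y => beta (a y) (b y) := by
  have hG : ∀ {f : Y → ℝ}, Continuous f → (∀ y, 0 < f y) →
      Continuous fun y => Real.Gamma (f y) := fun {f} hf hf0 =>
    continuous_iff_continuousAt.2 fun y =>
      (Real.differentiableAt_Gamma fun m h => by
        have := hf0 y; have hm : (0 : ℝ) ≤ m := m.cast_nonneg; linarith).continuousAt.comp
        (f := f) hf.continuousAt
  unfold beta
  exact ((hG ha ha0).mul (hG hb hb0)).div (hG (ha.add hb) fun y => add_pos (ha0 y) (hb0 y))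
    fun y => (Real.Gamma_pos_of_pos (add_pos (ha0 y) (hb0 y))).ne'

/-- Keeping `u` inside `(0,1)` fixes the branch of the density and keeps both power bases nonzero,
so that the exponents may vary continuously as well. -/
theorem continuous_betaPDFReal {a b u : Y → ℝ} (ha : Continuous a) (hb : Continuous b)
    (hu : Continuous u) (ha0 : ∀ y, 0 < a y) (hb0 : ∀ y, 0 < b y)
    (hu01 : ∀ y, u y ∈ Set.Ioo (0 : ℝ) 1) :
    Continuous fun y => betaPDFReal (a y) (b y) (u y) := by
  have : (fun y => betaPDFReal (a y) (b y) (u y)) = fun y =>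
      (1 / beta (a y) (b y)) * (u y) ^ (a y - 1) * (1 - u y) ^ (b y - 1) := by
    ext y
    exact if_pos (hu01 y)
  rw [this]
  refine ((continuous_const.div (continuous_beta ha hb ha0 hb0)
    fun y => (beta_pos (ha0 y) (hb0 y)).ne').mul ?_).mul ?_
  · exact hu.rpow (by fun_prop) fun y => Or.inl (hu01 y).1.ne'
  · exact (continuous_const.sub hu).rpow (by fun_prop)
      fun y => Or.inl (sub_pos.2 (hu01 y).2).ne'

theorem continuous_mixDensity {γl γr : ℝ} (hγl : 0 < γl) (hγr : 0 < γr) {ξ : Y → Param p}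
    {x : Y → Fin p → ℝ} {u : Y → ℝ} (hξ : Continuous ξ) (hx : Continuous x) (hu : Continuous u)
    (hu01 : ∀ y, u y ∈ Set.Ioo (0 : ℝ) 1) :
    Continuous fun y => mixDensity γl γr (ξ y) (x y) (u y) := by
  have hl := continuous_piL hξ.fst hx
  have hr := continuous_piR hξ.fst hx
  have hkl := continuous_shape hξ.snd.fst hx
  have hkr := continuous_shape hξ.snd.snd hx
  have h1 := continuous_betaPDFReal hkl continuous_const hu (fun y => shape_pos _ _)
    (fun _ => hγl) hu01
  have h2 := continuous_betaPDFReal continuous_const hkr hu (fun _ => hγr)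
    (fun y => shape_pos _ _) hu01
  unfold mixDensity hL hR
  exact (((continuous_const.sub hl).sub hr).add (hl.mul h1)).add (hr.mul h2)

end Continuity

/-! ### Positivity and the range of the assessor -/

section Pointwise

variable {p : ℕ} {γl γr : ℝ}

theorem piNull_lt_mixDensity (hγl : 0 < γl) (hγr : 0 < γr) (ξ : Param p) (x : Fin p → ℝ)
    {u : ℝ} (hu : u ∈ Set.Ioo (0 : ℝ) 1) :
    1 - piL ξ.1 x - piR ξ.1 x < mixDensity γl γr ξ x u := by
  have h1 : 0 < piL ξ.1 x * hL γl ξ.2 x u :=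
    mul_pos (piL_pos _ _) (betaPDFReal_pos hu.1 hu.2 (shape_pos _ _) hγl)
  have h2 : 0 < piR ξ.1 x * hR γr ξ.2 x u :=
    mul_pos (piR_pos _ _) (betaPDFReal_pos hu.1 hu.2 hγr (shape_pos _ _))
  unfold mixDensity
  linarith

theorem mixDensity_pos (hγl : 0 < γl) (hγr : 0 < γr) (ξ : Param p) (x : Fin p → ℝ)
    {u : ℝ} (hu : u ∈ Set.Ioo (0 : ℝ) 1) : 0 < mixDensity γl γr ξ x u :=
  (piNull_pos _ _).trans (piNull_lt_mixDensity hγl hγr ξ x hu)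

theorem assessor_pos (hγl : 0 < γl) (hγr : 0 < γr) (ξ : Param p) (x : Fin p → ℝ)
    {u : ℝ} (hu : u ∈ Set.Ioo (0 : ℝ) 1) : 0 < assessor γl γr ξ x u :=
  div_pos (piNull_pos _ _) (mixDensity_pos hγl hγr ξ x hu)

theorem assessor_lt_one (hγl : 0 < γl) (hγr : 0 < γr) (ξ : Param p) (x : Fin p → ℝ)
    {u : ℝ} (hu : u ∈ Set.Ioo (0 : ℝ) 1) : assessor γl γr ξ x u < 1 :=
  (div_lt_one (mixDensity_pos hγl hγr ξ x hu)).2 (piNull_lt_mixDensity hγl hγr ξ x hu)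

theorem continuous_assessor {Y : Type*} [TopologicalSpace Y] (hγl : 0 < γl) (hγr : 0 < γr)
    {ξ : Y → Param p} {x : Y → Fin p → ℝ} {u : Y → ℝ} (hξ : Continuous ξ) (hx : Continuous x)
    (hu : Continuous u) (hu01 : ∀ y, u y ∈ Set.Ioo (0 : ℝ) 1) :
    Continuous fun y => assessor γl γr (ξ y) (x y) (u y) := by
  unfold assessor
  exact ((continuous_const.sub (continuous_piL hξ.fst hx)).sub
    (continuous_piR hξ.fst hx)).div (continuous_mixDensity hγl hγr hξ hx hu hu01)
    fun y => (mixDensity_pos hγl hγr _ _ (hu01 y)).ne'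

end Pointwise

/-! ### Strict convexity of the mixture density and level sets of the assessor -/

section Convexity

/-- Write `u ^ s = exp (s log u)`: the exponent is strictly convex because `log` is strictly concave
and `s < 0`, and `exp` is increasing and convex. -/
theorem strictConvexOn_rpow_neg {s : ℝ} (hs : s < 0) :
    StrictConvexOn ℝ (Set.Ioi 0) fun u : ℝ => u ^ s := by
  refine ⟨convex_Ioi 0, fun x hx y hy hxy a b ha hb hab => ?_⟩
  have hm : 0 < a • x + b • y := by
    simp only [smul_eq_mul]
    exact add_pos (mul_pos ha hx) (mul_pos hb hy)
  have h1 := strictConcaveOn_log_Ioi.2 hx hy hxy ha hb hab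
  have h2 := convexOn_exp.2 (Set.mem_univ (Real.log x * s)) (Set.mem_univ (Real.log y * s))
    ha.le hb.le hab
  simp only at h1 h2 ⊢
  rw [Real.rpow_def_of_pos hm, Real.rpow_def_of_pos hx, Real.rpow_def_of_pos hy]
  refine (Real.exp_lt_exp.2 ?_).trans_le h2
  simp only [smul_eq_mul] at h1 ⊢
  nlinarith

theorem convexOn_one_sub_rpow {s : ℝ} (hs : 1 ≤ s) :
    ConvexOn ℝ (Set.Iic 1) fun u : ℝ => (1 - u) ^ s := by
  refine ⟨convex_Iic 1, fun x hx y hy a b ha hb hab => ?_⟩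
  have h := (convexOn_rpow hs).2 (x := 1 - x) (y := 1 - y) (by simpa using hx)
    (by simpa using hy) ha hb hab
  convert h using 2
  simp only [smul_eq_mul]
  linear_combination -hab

/-- Both factors are nonnegative, convex and decreasing. Expanding the product of the two convexity
bounds leaves the surplus `a b (f x - f y)(g x - g y)`, which is nonnegative for functions monotone
in the same direction. Strictness comes from the first factor, the second being positive inside the
interval. -/
theorem strictConvexOn_rpow_mul_rpow {s t : ℝ} (hs : s < 0) (ht : 1 ≤ t) :
    StrictConvexOn ℝ (Set.Ioo 0 1) fun u : ℝ => u ^ s * (1 - u) ^ t := by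
  refine ⟨convex_Ioo 0 1, fun x hx y hy hxy a b ha hb hab => ?_⟩
  have hm : a • x + b • y ∈ Set.Ioo (0 : ℝ) 1 := convex_Ioo 0 1 hx hy ha.le hb.le hab
  have hp := (strictConvexOn_rpow_neg hs).2 hx.1 hy.1 hxy ha hb hab
  have hq := (convexOn_one_sub_rpow ht).2 (Set.mem_Iic.2 hx.2.le) (Set.mem_Iic.2 hy.2.le)
    ha.le hb.le hab
  have hqm : 0 < (1 - (a • x + b • y)) ^ t := Real.rpow_pos_of_pos (sub_pos.2 hm.2) _
  have hpx : 0 < x ^ s := Real.rpow_pos_of_pos hx.1 _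
  have hpy : 0 < y ^ s := Real.rpow_pos_of_pos hy.1 _
  have hcross : 0 ≤ (x ^ s - y ^ s) * ((1 - x) ^ t - (1 - y) ^ t) := by
    rcases le_total x y with h | h
    · exact mul_nonneg (sub_nonneg.2 (Real.rpow_le_rpow_of_nonpos hx.1 h hs.le))
        (sub_nonneg.2 (Real.rpow_le_rpow (sub_nonneg.2 hy.2.le) (by linarith) (by linarith)))
    · exact mul_nonneg_of_nonpos_of_nonpos
        (sub_nonpos.2 (Real.rpow_le_rpow_of_nonpos hy.1 h hs.le))
        (sub_nonpos.2 (Real.rpow_le_rpow (sub_nonneg.2 hx.2.le) (by linarith) (by linarith)))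
  simp only [smul_eq_mul] at hp hq hqm ⊢
  calc _ < (a * x ^ s + b * y ^ s) * (1 - (a * x + b * y)) ^ t :=
        mul_lt_mul_of_pos_right hp hqm
    _ ≤ (a * x ^ s + b * y ^ s) * (a * (1 - x) ^ t + b * (1 - y) ^ t) :=
        mul_le_mul_of_nonneg_left hq (by positivity)
    _ = a * (x ^ s * (1 - x) ^ t) + b * (y ^ s * (1 - y) ^ t)
        - a * b * ((x ^ s - y ^ s) * ((1 - x) ^ t - (1 - y) ^ t)) := by
        obtain rfl : b = 1 - a := by linarith
        ring
    _ ≤ _ := by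
        have := mul_nonneg (mul_nonneg ha.le hb.le) hcross
        linarith

theorem strictConvexOn_betaPDFReal_left {k γ : ℝ} (hk0 : 0 < k) (hk : k < 1) (hγ : 2 < γ) :
    StrictConvexOn ℝ (Set.Ioo 0 1) (betaPDFReal k γ) := by
  have h := strictConvexOn_rpow_mul_rpow (s := k - 1) (t := γ - 1) (by linarith) (by linarith)
  have hB : 0 < 1 / beta k γ := one_div_pos.2 (beta_pos hk0 (by linarith))
  refine ⟨h.1, fun x hx y hy hxy a b ha hb hab => ?_⟩
  have hm := h.1 hx hy ha.le hb.le hab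
  have := mul_lt_mul_of_pos_left (h.2 hx hy hxy ha hb hab) hB
  have e : ∀ {u : ℝ}, u ∈ Set.Ioo (0 : ℝ) 1 →
      betaPDFReal k γ u = (1 / beta k γ) * u ^ (k - 1) * (1 - u) ^ (γ - 1) := fun hu => if_pos hu
  rw [e hm, e hx, e hy]
  simp only [smul_eq_mul] at this ⊢
  linarith

/-- The reflection `u ↦ 1 - u` reduces every statement on the right component to one on the left
component. -/
theorem betaPDFReal_one_sub (a b u : ℝ) : betaPDFReal a b (1 - u) = betaPDFReal b a u := by
  simp only [betaPDFReal, beta, sub_pos, sub_lt_self_iff, sub_sub_cancel]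
  refine if_congr and_comm ?_ rfl
  rw [add_comm a b, mul_comm (Real.Gamma a)]
  ring

theorem strictConvexOn_betaPDFReal_right {k γ : ℝ} (hk0 : 0 < k) (hk : k < 1) (hγ : 2 < γ) :
    StrictConvexOn ℝ (Set.Ioo 0 1) (betaPDFReal γ k) := by
  have h := strictConvexOn_betaPDFReal_left hk0 hk hγ
  refine ⟨h.1, fun x hx y hy hxy a b ha hb hab => ?_⟩
  have hsub : ∀ {z : ℝ}, z ∈ Set.Ioo (0 : ℝ) 1 → 1 - z ∈ Set.Ioo (0 : ℝ) 1 :=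
    fun hz => ⟨by linarith [hz.2], by linarith [hz.1]⟩
  have := h.2 (hsub hx) (hsub hy) (by simpa using hxy) ha hb hab
  have e : a • (1 - x) + b • (1 - y) = 1 - (a • x + b • y) := by
    simp only [smul_eq_mul]; linear_combination hab
  rwa [e, betaPDFReal_one_sub, betaPDFReal_one_sub, betaPDFReal_one_sub] at this

/-- A strictly convex function takes each value at most twice. -/
theorem _root_.StrictConvexOn.finite_level {s : Set ℝ} {f : ℝ → ℝ} (hf : StrictConvexOn ℝ s f)
    (c : ℝ) : {u ∈ s | f u = c}.Finite := by
  by_contra hinf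
  obtain ⟨t, hts, ht⟩ := (show {u ∈ s | f u = c}.Infinite from hinf).exists_subset_card_eq 3
  -- Of three points on one level, the middle one would have to lie strictly below that level.
  have key : ∀ x y z : ℝ, x ∈ t → y ∈ t → z ∈ t → x < y → y < z → False := by
    intro x y z hx hy hz hxy hyz
    have h := hf.lt_on_openSegment (hts hx).1 (hts hz).1 (hxy.trans hyz).ne
      (z := y) (by rw [openSegment_eq_Ioo (hxy.trans hyz)]; exact ⟨hxy, hyz⟩)
    rw [(hts hx).2, (hts hy).2, (hts hz).2, max_self] at h
    exact lt_irrefl _ h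
  obtain ⟨x, y, z, hxy, hxz, hyz, rfl⟩ := Finset.card_eq_three.1 ht
  have hx : x ∈ ({x, y, z} : Finset ℝ) := by simp
  have hy : y ∈ ({x, y, z} : Finset ℝ) := by simp
  have hz : z ∈ ({x, y, z} : Finset ℝ) := by simp
  rcases hxy.lt_or_gt with h1 | h1 <;> rcases hxz.lt_or_gt with h2 | h2 <;>
    rcases hyz.lt_or_gt with h3 | h3
  · exact key _ _ _ hx hy hz h1 h3
  · exact key _ _ _ hx hz hy h2 h3
  · exact lt_irrefl _ (h1.trans (h3.trans h2))
  · exact key _ _ _ hz hx hy h2 h1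
  · exact key _ _ _ hy hx hz h1 h2
  · exact lt_irrefl _ (h1.trans (h2.trans h3))
  · exact key _ _ _ hy hz hx h3 h2
  · exact key _ _ _ hz hy hx h3 h1

variable {p : ℕ} {γl γr : ℝ}

theorem strictConvexOn_mixDensity (hγl : 2 < γl) (hγr : 2 < γr) (ξ : Param p)
    (x : Fin p → ℝ) : StrictConvexOn ℝ (Set.Ioo 0 1) (mixDensity γl γr ξ x) := by
  have h1 := strictConvexOn_betaPDFReal_left (shape_pos ξ.2.1 x) (shape_lt_one ξ.2.1 x) hγl
  have h2 := strictConvexOn_betaPDFReal_right (shape_pos ξ.2.2 x) (shape_lt_one ξ.2.2 x) hγr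
  refine ⟨h1.1, fun u hu v hv huv a b ha hb hab => ?_⟩
  have e1 := mul_lt_mul_of_pos_left (h1.2 hu hv huv ha hb hab) (piL_pos ξ.1 x)
  have e2 := mul_lt_mul_of_pos_left (h2.2 hu hv huv ha hb hab) (piR_pos ξ.1 x)
  obtain rfl : b = 1 - a := by linarith
  simp only [smul_eq_mul, mixDensity, hL, hR] at e1 e2 ⊢
  linarith

/-- The assessor is a positive constant divided by a strictly convex function, so it takes each
value at most twice. Hence `a_x(V)` has no atoms for uniform `V`. -/
theorem finite_assessor_level (hγl : 2 < γl) (hγr : 2 < γr) (ξ : Param p)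
    (x : Fin p → ℝ) (t : ℝ) :
    {u ∈ Set.Ioo (0 : ℝ) 1 | assessor γl γr ξ x u = t}.Finite := by
  refine ((strictConvexOn_mixDensity hγl hγr ξ x).finite_level
    ((1 - piL ξ.1 x - piR ξ.1 x) / t)).subset fun u hu => ⟨hu.1, ?_⟩
  have h := mixDensity_pos (by linarith) (by linarith) ξ x hu.1 (γl := γl) (γr := γr)
  have h0 := piNull_pos ξ.1 x
  rw [← hu.2, assessor]
  field_simp

end Convexity

/-! ## The null distribution function of the assessor -/

section NullCDF

variable {p : ℕ} {γl γr : ℝ}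

theorem continuousOn_assessor (hγl : 0 < γl) (hγr : 0 < γr) (ξ : Param p) (x : Fin p → ℝ) :
    ContinuousOn (assessor γl γr ξ x) (Set.Ioo 0 1) := by
  rw [continuousOn_iff_continuous_domRestrict]
  exact continuous_assessor (Y := Set.Ioo (0 : ℝ) 1) hγl hγr continuous_const continuous_const
    continuous_subtype_val fun y => y.2

theorem aemeasurable_assessor (hγl : 0 < γl) (hγr : 0 < γr) (ξ : Param p) (x : Fin p → ℝ) :
    AEMeasurable (assessor γl γr ξ x) (volume.restrict (Set.Ioo (0 : ℝ) 1)) :=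
  (continuousOn_assessor hγl hγr ξ x).aemeasurable measurableSet_Ioo

instance isProbabilityMeasure_uniform :
    IsProbabilityMeasure (volume.restrict (Set.Ioo (0 : ℝ) 1)) :=
  ⟨by simp⟩

theorem nullCDF_nonneg (ξ : Param p) (x : Fin p → ℝ) (t : ℝ) : 0 ≤ nullCDF γl γr ξ x t :=
  measureReal_nonneg

theorem nullCDF_le_one (ξ : Param p) (x : Fin p → ℝ) (t : ℝ) : nullCDF γl γr ξ x t ≤ 1 :=
  measureReal_le_one

theorem nullCDF_mono (ξ : Param p) (x : Fin p → ℝ) : Monotone (nullCDF γl γr ξ x) :=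
  fun _ _ hst => measureReal_mono fun _ hu => le_trans hu hst

theorem nullCDF_of_nonpos (hγl : 0 < γl) (hγr : 0 < γr) (ξ : Param p) (x : Fin p → ℝ) {t : ℝ}
    (ht : t ≤ 0) : nullCDF γl γr ξ x t = 0 := by
  have : ∀ᵐ u ∂(volume.restrict (Set.Ioo (0 : ℝ) 1)), ¬ assessor γl γr ξ x u ≤ t := by
    filter_upwards [ae_restrict_mem measurableSet_Ioo] with u hu
    exact not_le.2 (ht.trans_lt (assessor_pos hγl hγr ξ x hu))
  rw [nullCDF, measureReal_def]
  rw [ae_iff] at this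
  simp only [not_not] at this
  rw [this, ENNReal.toReal_zero]

theorem nullCDF_of_one_le (hγl : 0 < γl) (hγr : 0 < γr) (ξ : Param p) (x : Fin p → ℝ) {t : ℝ}
    (ht : 1 ≤ t) : nullCDF γl γr ξ x t = 1 := by
  have : ∀ᵐ u ∂(volume.restrict (Set.Ioo (0 : ℝ) 1)), assessor γl γr ξ x u ≤ t := by
    filter_upwards [ae_restrict_mem measurableSet_Ioo] with u hu
    exact (assessor_lt_one hγl hγr ξ x hu).le.trans ht
  rw [nullCDF, measureReal_def,
    measure_congr (show {u | assessor γl γr ξ x u ≤ t} =ᵐ[_] Set.univ from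
      eventuallyEq_univ.2 this), measure_univ, ENNReal.toReal_one]

theorem ae_assessor_ne (hγl : 2 < γl) (hγr : 2 < γr) (ξ : Param p) (x : Fin p → ℝ) (t : ℝ) :
    ∀ᵐ u ∂(volume.restrict (Set.Ioo (0 : ℝ) 1)), assessor γl γr ξ x u ≠ t := by
  rw [ae_restrict_iff' measurableSet_Ioo, ae_iff]
  refine measure_mono_null (fun u hu => ?_)
    ((finite_assessor_level hγl hγr ξ x t).measure_zero volume)
  simpa [and_assoc] using hu

/-- Dominated convergence: the indicator of `a(u) ≤ t` is locally constant in the parameters at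
every `u` with `a(u) ≠ t`, and the exceptional `u` form a null set. -/
theorem continuous_nullCDF {Y : Type*} [TopologicalSpace Y] [FirstCountableTopology Y]
    (hγl : 2 < γl) (hγr : 2 < γr) {ξ : Y → Param p} {x : Y → Fin p → ℝ} {t : Y → ℝ}
    (hξ : Continuous ξ) (hx : Continuous x) (ht : Continuous t) :
    Continuous fun y => nullCDF γl γr (ξ y) (x y) (t y) := by
  have hl : 0 < γl := by linarith
  have hr : 0 < γr := by linarith
  refine continuous_iff_continuousAt.2 fun y => ?_
  have hmeas : ∀ y, NullMeasurableSet {u | assessor γl γr (ξ y) (x y) u ≤ t y}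
      (volume.restrict (Set.Ioo (0 : ℝ) 1)) := fun y =>
    nullMeasurableSet_le (aemeasurable_assessor hl hr _ _) aemeasurable_const
  have hint : ∀ y, nullCDF γl γr (ξ y) (x y) (t y) =
      ∫ u in Set.Ioo (0 : ℝ) 1,
        Set.indicator {u | assessor γl γr (ξ y) (x y) u ≤ t y} (fun _ => (1 : ℝ)) u := fun y => by
    rw [integral_indicator₀ (hmeas y), setIntegral_const, smul_eq_mul, mul_one, nullCDF]
  simp only [ContinuousAt, hint]
  refine tendsto_integral_filter_of_dominated_convergence (fun _ => 1)
    (Eventually.of_forall fun y => (aestronglyMeasurable_const.indicator₀ (hmeas y)))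
    (Eventually.of_forall fun y => Eventually.of_forall fun u => ?_) (integrable_const _) ?_
  · rw [Set.indicator_apply]; split_ifs <;> simp
  · filter_upwards [ae_assessor_ne hγl hγr (ξ y) (x y) (t y),
      ae_restrict_mem measurableSet_Ioo] with u hne hu
    have hc : Tendsto (fun y => assessor γl γr (ξ y) (x y) u) (𝓝 y)
        (𝓝 (assessor γl γr (ξ y) (x y) u)) :=
      (continuous_assessor hl hr hξ hx continuous_const fun _ => hu).tendsto y
    refine tendsto_const_nhds.congr' ?_
    rcases hne.lt_or_gt with h | h
    · filter_upwards [hc.eventually_lt (ht.tendsto y) h] with z hz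
      simp [h.le, hz.le]
    · filter_upwards [(ht.tendsto y).eventually_lt hc h] with z hz
      simp [not_le.2 h, not_le.2 hz]

/-- The infimum is attained: continuity of `c_x` makes the candidate set closed, and `s ≤ 1 =
c_x(1)` makes it nonempty. -/
theorem nullQuantile_le_iff (hγl : 2 < γl) (hγr : 2 < γr) (ξ : Param p) (x : Fin p → ℝ)
    {s t : ℝ} (hs : s ≤ 1) (ht : t ∈ Set.Icc (0 : ℝ) 1) :
    nullQuantile γl γr ξ x s ≤ t ↔ s ≤ nullCDF γl γr ξ x t := by
  have hbdd : BddBelow {t : ℝ | t ∈ Set.Icc (0 : ℝ) 1 ∧ s ≤ nullCDF γl γr ξ x t} :=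
    ⟨0, fun t ht => ht.1.1⟩
  refine ⟨fun h => ?_, fun h => csInf_le hbdd ⟨ht, h⟩⟩
  have hclosed : IsClosed {t : ℝ | t ∈ Set.Icc (0 : ℝ) 1 ∧ s ≤ nullCDF γl γr ξ x t} :=
    isClosed_Icc.inter (isClosed_le continuous_const
      (continuous_nullCDF hγl hγr continuous_const continuous_const continuous_id))
  have hne : {t : ℝ | t ∈ Set.Icc (0 : ℝ) 1 ∧ s ≤ nullCDF γl γr ξ x t}.Nonempty :=
    ⟨1, by simp, by rwa [nullCDF_of_one_le (by linarith) (by linarith) ξ x le_rfl]⟩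
  exact (hclosed.csInf_mem hne hbdd).2.trans (nullCDF_mono ξ x h)

/-- Removes the quantile function: mirror events become inequalities between functions that are
continuous in the data and the parameter. -/
theorem mirror_le_iff (hγl : 2 < γl) (hγr : 2 < γr) (ξ : Param p) (x : Fin p → ℝ)
    {u t : ℝ} (ht : t ∈ Set.Icc (0 : ℝ) 1) :
    mirror γl γr ξ x u ≤ t ↔ 1 - sStat γl γr ξ x u ≤ nullCDF γl γr ξ x t :=
  nullQuantile_le_iff hγl hγr ξ x
    (sub_le_self 1 (nullCDF_nonneg ξ x (assessor γl γr ξ x u))) ht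

end NullCDF

/-! ## The null distribution of the `u`-values -/

section UValue

theorem continuous_uValue : Continuous uValue := by
  have h : ∀ z, uValue z = (gaussianReal 0 1).real (Set.Iic z) := fun z => cdf_eq_real _ z
  rw [continuous_iff_continuousAt]
  intro z
  have hr := (cdf (gaussianReal 0 1)).right_continuous z
  have hl : ContinuousWithinAt uValue (Set.Iic z) z := by
    -- The jump of the distribution function at `z` is the Gaussian mass of `{z}`, which vanishes.
    have h0 : (cdf (gaussianReal 0 1)).measure {z} = 0 := by
      have := nullSingletonClass_gaussianReal (μ := 0) (v := 1) one_ne_zero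
      rw [measure_cdf]; exact measure_singleton z
    rw [StieltjesFunction.measure_singleton, ENNReal.ofReal_eq_zero, sub_nonpos] at h0
    have := (cdf (gaussianReal 0 1)).mono.continuousWithinAt_Iio_iff_leftLim_eq (x := z)
    have h1 := (cdf (gaussianReal 0 1)).mono.leftLim_le (le_refl z)
    exact continuousWithinAt_Iio_iff_Iic.1 (this.2 (le_antisymm h1 h0))
  exact continuousAt_iff_continuous_left_right.2 ⟨hl, hr⟩

theorem strictMono_uValue : StrictMono uValue := by
  intro a b hab
  have h : (cdf (gaussianReal 0 1)).measure (Set.Ioc a b) ≠ 0 := by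
    rw [measure_cdf]
    intro h0
    have := gaussianReal_absolutelyContinuous' 0 one_ne_zero h0
    rw [Real.volume_Ioc, ENNReal.ofReal_eq_zero] at this
    linarith
  rw [StieltjesFunction.measure_Ioc] at h
  simpa [uValue] using h

theorem uValue_mem (z : ℝ) : uValue z ∈ Set.Ioo (0 : ℝ) 1 :=
  ⟨(cdf_nonneg _ (z - 1)).trans_lt (strictMono_uValue (by linarith)),
    (strictMono_uValue (show z < z + 1 by linarith)).trans_le (cdf_le_one _ _)⟩

theorem exists_uValue_eq {a : ℝ} (ha : a ∈ Set.Ioo (0 : ℝ) 1) : ∃ z, uValue z = a := by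
  obtain ⟨x, hx⟩ := ((tendsto_cdf_atBot (gaussianReal 0 1)).eventually_lt_const ha.1).exists
  obtain ⟨y, hy⟩ := ((tendsto_cdf_atTop (gaussianReal 0 1)).eventually_const_lt ha.2).exists
  exact mem_range_of_exists_le_of_exists_ge continuous_uValue ⟨x, hx.le⟩ ⟨y, hy.le⟩

/-- The probability integral transform, checked on half-lines. It links the Gaussian test statistic
to `nullCDF`, which is defined through the uniform law. -/
theorem map_uValue : (gaussianReal 0 1).map uValue = volume.restrict (Set.Ioo (0 : ℝ) 1) := by
  have : IsProbabilityMeasure ((gaussianReal 0 1).map uValue) :=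
    Measure.isProbabilityMeasure_map continuous_uValue.measurable.aemeasurable
  refine Measure.ext_of_Iic _ _ fun a => ?_
  rw [Measure.map_apply continuous_uValue.measurable measurableSet_Iic,
    Measure.restrict_apply measurableSet_Iic]
  rcases le_or_gt a 0 with h0 | h0
  · rw [show uValue ⁻¹' Set.Iic a = ∅ from Set.eq_empty_of_forall_notMem fun z hz =>
      absurd (le_trans hz h0) (not_le.2 (uValue_mem z).1),
      show Set.Iic a ∩ Set.Ioo 0 1 = ∅ from Set.eq_empty_of_forall_notMem fun z hz =>
      absurd (le_trans hz.1 h0) (not_le.2 hz.2.1), measure_empty, measure_empty]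
  rcases le_or_gt 1 a with h1 | h1
  · rw [show uValue ⁻¹' Set.Iic a = Set.univ from Set.eq_univ_of_forall fun z =>
      (uValue_mem z).2.le.trans h1,
      show Set.Iic a ∩ Set.Ioo 0 1 = Set.Ioo 0 1 from
        Set.inter_eq_right.2 fun z hz => hz.2.le.trans h1]
    simp
  obtain ⟨z, rfl⟩ := exists_uValue_eq ⟨h0, h1⟩
  rw [show uValue ⁻¹' Set.Iic (uValue z) = Set.Iic z from
      Set.ext fun y => strictMono_uValue.le_iff_le,
    show Set.Iic (uValue z) ∩ Set.Ioo 0 1 = Set.Ioc 0 (uValue z) from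
      Set.ext fun y => ⟨fun h => ⟨h.2.1, h.1⟩, fun h => ⟨h.2, h.1, h.2.trans_lt h1⟩⟩,
    Real.volume_Ioc, sub_zero]
  exact (ofReal_cdf _ z).symm

variable {p : ℕ} {γl γr : ℝ}

theorem gaussianReal_assessor_le (hγl : 0 < γl) (hγr : 0 < γr) (ξ : Param p) (x : Fin p → ℝ)
    (t : ℝ) : (gaussianReal 0 1).real {z | assessor γl γr ξ x (uValue z) ≤ t} =
      nullCDF γl γr ξ x t := by
  have h : NullMeasurableSet {u | assessor γl γr ξ x u ≤ t}
      ((gaussianReal 0 1).map uValue) := by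
    rw [map_uValue]
    exact nullMeasurableSet_le (aemeasurable_assessor hγl hγr _ _) aemeasurable_const
  rw [nullCDF, ← map_uValue, measureReal_def, measureReal_def,
    Measure.map_apply₀ continuous_uValue.measurable.aemeasurable h]
  rfl

/-- Under the null, the probability integral transform of the assessor is stochastically at least
uniform. -/
theorem gaussianReal_sStat_lt_le (hγl : 2 < γl) (hγr : 2 < γr) (ξ : Param p) (x : Fin p → ℝ)
    {s : ℝ} (hs : s ∈ Set.Icc (0 : ℝ) 1) :
    (gaussianReal 0 1).real {z | sStat γl γr ξ x (uValue z) < s} ≤ s := by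
  have hc : ContinuousOn (nullCDF γl γr ξ x) (Set.Icc 0 1) :=
    (continuous_nullCDF hγl hγr continuous_const continuous_const continuous_id).continuousOn
  have hivt := intermediate_value_Icc zero_le_one hc
  rw [nullCDF_of_nonpos (by linarith) (by linarith) ξ x le_rfl,
    nullCDF_of_one_le (by linarith) (by linarith) ξ x le_rfl] at hivt
  -- With `c(t) = s`, the event `S < s` forces `T ≤ t` by monotonicity, and that event has null
  -- probability `c(t) = s`.
  obtain ⟨t, -, ht⟩ := hivt hs
  calc _ ≤ (gaussianReal 0 1).real {z | assessor γl γr ξ x (uValue z) ≤ t} := by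
        refine measureReal_mono fun u hu => ?_
        by_contra hcon
        have := nullCDF_mono (γl := γl) (γr := γr) ξ x (not_le.1 hcon).le
        exact absurd (ht ▸ this) (not_le.2 hu)
    _ = s := by rw [gaussianReal_assessor_le (by linarith) (by linarith), ht]

end UValue

/-! ## Uniform strong laws over compact parameter sets -/

section UniformLaw

variable {Ω : Type*} [MeasurableSpace Ω] {P : Measure Ω}
  {E : Type*} [TopologicalSpace E] [SecondCountableTopology E] [MeasurableSpace E] [BorelSpace E]
  {W : ℕ → Ω → E}

/-- The strong law of large numbers in the Banach space of continuous functions on a compact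
parameter space. -/
theorem uniform_strong_law {Q : Type*} [TopologicalSpace Q] [CompactSpace Q]
    (hW : ∀ i, Measurable (W i)) (hind : iIndepFun W P)
    (hid : ∀ i, IdentDistrib (W i) (W 0) P P) (g : C(E × Q, ℝ)) {M : Ω → ℝ}
    (hM : Integrable M P) (hgM : ∀ᵐ ω ∂P, ∀ q, |g (W 0 ω, q)| ≤ M ω) :
    ∃ F : C(Q, ℝ), (∀ q, F q = ∫ ω, g (W 0 ω, q) ∂P) ∧ ∀ᵐ ω ∂P,
      Tendsto (fun n : ℕ => (n : ℝ)⁻¹ • ∑ i ∈ Finset.range n, g.curry (W i ω)) atTop (𝓝 F) := by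
  borelize C(Q, ℝ)
  have hc : Continuous (g.curry : E → C(Q, ℝ)) := g.curry.continuous
  -- Strong measurability comes from second countability of `E`, so `C(Q, ℝ)` need not be separable.
  have hint : Integrable (fun ω => g.curry (W 0 ω)) P := by
    refine hM.abs.mono' (hc.stronglyMeasurable.comp_measurable (hW 0)).aestronglyMeasurable ?_
    filter_upwards [hgM] with ω hω
    exact (ContinuousMap.norm_le _ (abs_nonneg _)).2 fun q => (hω q).trans (le_abs_self _)
  refine ⟨∫ ω, g.curry (W 0 ω) ∂P, fun q => ?_, ?_⟩
  · exact ((ContinuousMap.evalCLM ℝ q).integral_comp_comm hint).symm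
  · exact strong_law_ae (fun i ω => g.curry (W i ω)) hint
      (fun i j hij => (hind.indepFun hij).comp hc.measurable hc.measurable)
      fun i => (hid i).comp hc.measurable

variable [IsProbabilityMeasure P]

/-- Sample means of `g` at a consistent estimate, uniformly over a second compact parameter. -/
theorem uniform_law_at_estimate {Q J : Type*} [MetricSpace Q] [CompactSpace Q] [MetricSpace J]
    [CompactSpace J] (hW : ∀ i, Measurable (W i)) (hind : iIndepFun W P)
    (hid : ∀ i, IdentDistrib (W i) (W 0) P P) (g : C(E × (Q × J), ℝ)) {C : ℝ}
    (hg : ∀ w, |g w| ≤ C) {q₀ : Q} {q : ℕ → Ω → Q}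
    (hq : ∀ᵐ ω ∂P, Tendsto (fun n => q n ω) atTop (𝓝 q₀)) :
    ∀ᵐ ω ∂P, ∀ η > 0, ∀ᶠ n : ℕ in atTop, ∀ t : J,
      |(∑ i ∈ Finset.range n, g (W i ω, (q n ω, t))) / n - ∫ ω', g (W 0 ω', (q₀, t)) ∂P| < η := by
  obtain ⟨F, hF, hlim⟩ := uniform_strong_law hW hind hid g (integrable_const C)
    (Eventually.of_forall fun ω q => hg _)
  -- The error splits into the sup-norm distance of the sample mean from `F` and the change of `F`
  -- from `q n` to `q₀`, which uniform continuity controls simultaneously for all `t`.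
  have huc : UniformContinuous F := CompactSpace.uniformContinuous_of_continuous F.continuous
  filter_upwards [hlim, hq] with ω h1 h2 η hη
  obtain ⟨δ, hδ, hFδ⟩ := Metric.uniformContinuous_iff.1 huc (η / 2) (half_pos hη)
  filter_upwards [Metric.tendsto_nhds.1 h1 (η / 2) (half_pos hη), Metric.tendsto_nhds.1 h2 δ hδ]
    with n h3 h4 t
  rw [← hF]
  have h5 := (ContinuousMap.dist_lt_iff (half_pos hη)).1 h3 (q n ω, t)
  have h6 : dist (F (q n ω, t)) (F (q₀, t)) < η / 2 :=
    hFδ (by rw [Prod.dist_eq, dist_self]; exact max_lt h4 hδ)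
  have h7 : ((n : ℝ)⁻¹ • ∑ i ∈ Finset.range n, g.curry (W i ω)) (q n ω, t) =
      (∑ i ∈ Finset.range n, g (W i ω, (q n ω, t))) / n := by
    simp [div_eq_inv_mul]
  rw [h7] at h5
  rw [← Real.dist_eq]
  linarith [dist_triangle ((∑ i ∈ Finset.range n, g (W i ω, (q n ω, t))) / n)
    (F (q n ω, t)) (F (q₀, t))]

/-- Consistency of approximate maximizers of uniformly convergent criterion functions. -/
theorem tendsto_of_isMaxOn {Q : Type*} [TopologicalSpace Q] [CompactSpace Q] {F : C(Q, ℝ)}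
    {f : ℕ → C(Q, ℝ)} (hf : Tendsto f atTop (𝓝 F)) {q₀ : Q} (hq₀ : ∀ q, q ≠ q₀ → F q < F q₀)
    {q : ℕ → Q} (hq : ∀ n, f n q₀ ≤ f n (q n)) : Tendsto q atTop (𝓝 q₀) := by
  refine tendsto_nhds.2 fun U hU hqU => ?_
  rcases (Uᶜ).eq_empty_or_nonempty with h | h
  · rw [Set.compl_empty_iff] at h
    simp [h]
  obtain ⟨y, hy, hmax⟩ := hU.isClosed_compl.isCompact.exists_isMaxOn h F.continuous.continuousOn
  have hlt : F y < F q₀ := hq₀ y fun e => hy (e ▸ hqU)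
  -- If both errors, at `q₀` and at `q n`, are below half the gap between `F q₀` and the maximum of
  -- `F` off `U`, then `q n` outside `U` would contradict `f n q₀ ≤ f n (q n)`.
  have hη : 0 < (F q₀ - F y) / 2 := by linarith
  filter_upwards [Metric.tendsto_nhds.1 hf _ hη] with n hn
  by_contra hcon
  have h1 := (ContinuousMap.dist_lt_iff hη).1 hn q₀
  have h2 := (ContinuousMap.dist_lt_iff hη).1 hn (q n)
  have h3 : F (q n) ≤ F y := hmax hcon
  rw [Real.dist_eq, abs_lt] at h1 h2
  linarith [hq n]

end UniformLaw

/-- The strong law for relative frequencies. -/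
theorem strong_law_frequency {Ω E : Type*} [MeasurableSpace Ω] {P : Measure Ω}
    [IsProbabilityMeasure P] [MeasurableSpace E] {W : ℕ → Ω → E}
    (hW : ∀ i, Measurable (W i)) (hind : iIndepFun W P)
    (hid : ∀ i, IdentDistrib (W i) (W 0) P P) {A : E → Prop} [DecidablePred A]
    (hA : MeasurableSet {w | A w}) :
    ∀ᵐ ω ∂P, Tendsto (fun n : ℕ =>
      (((Finset.range n).filter fun i => A (W i ω)).card : ℝ) / n) atTop
        (𝓝 (P.real {ω | A (W 0 ω)})) := by
  have hf : Measurable fun w : E => if A w then (1 : ℝ) else 0 :=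
    Measurable.ite hA measurable_const measurable_const
  have h := strong_law_ae_real (fun i ω => if A (W i ω) then (1 : ℝ) else 0)
    ((integrable_const (1 : ℝ)).mono' (hf.comp (hW 0)).aestronglyMeasurable
      (Eventually.of_forall fun ω => by split_ifs <;> simp))
    (fun i j hij => (hind.indepFun hij).comp hf hf) fun i => (hid i).comp hf
  have e : ∫ ω, (if A (W 0 ω) then (1 : ℝ) else 0) ∂P = P.real {ω | A (W 0 ω)} := by
    have h1 : (fun ω => if A (W 0 ω) then (1 : ℝ) else 0) =
        Set.indicator {ω | A (W 0 ω)} 1 := by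
      ext ω; simp [Set.indicator_apply]
    rw [h1]
    exact integral_indicator_one (hW 0 hA)
  rw [e] at h
  simpa only [Finset.sum_boole] using h

/-! ## Measurability of the procedure -/

section Measurability

variable {p : ℕ} {γl γr : ℝ}

theorem continuous_assessor_uValue {Y : Type*} [TopologicalSpace Y] (hγl : 2 < γl) (hγr : 2 < γr)
    {ξ : Y → Param p} {x : Y → Fin p → ℝ} {z : Y → ℝ} (hξ : Continuous ξ) (hx : Continuous x)
    (hz : Continuous z) : Continuous fun y => assessor γl γr (ξ y) (x y) (uValue (z y)) :=
  continuous_assessor (by linarith) (by linarith) hξ hx (continuous_uValue.comp hz)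
    fun _ => uValue_mem _

theorem continuous_sStat_uValue {Y : Type*} [TopologicalSpace Y] [FirstCountableTopology Y]
    (hγl : 2 < γl) (hγr : 2 < γr) {ξ : Y → Param p} {x : Y → Fin p → ℝ} {z : Y → ℝ}
    (hξ : Continuous ξ) (hx : Continuous x) (hz : Continuous z) :
    Continuous fun y => sStat γl γr (ξ y) (x y) (uValue (z y)) :=
  continuous_nullCDF hγl hγr hξ hx (continuous_assessor_uValue hγl hγr hξ hx hz)

variable {Ω : Type*} [MeasurableSpace Ω] {ξ : Ω → Param p} {X : ℕ → Ω → Fin p → ℝ}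
  {Z : ℕ → Ω → ℝ}

theorem measurable_comp_triple {f : Param p × (Fin p → ℝ) × ℝ → ℝ} (hf : Continuous f)
    (hξ : Measurable ξ) (hX : ∀ i, Measurable (X i)) (hZ : ∀ i, Measurable (Z i)) (i : ℕ) :
    Measurable fun ω => f (ξ ω, X i ω, Z i ω) :=
  hf.measurable.comp (hξ.prodMk ((hX i).prodMk (hZ i)))

theorem measurable_assessor (hγl : 2 < γl) (hγr : 2 < γr) (hξ : Measurable ξ)
    (hX : ∀ i, Measurable (X i)) (hZ : ∀ i, Measurable (Z i)) (i : ℕ) :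
    Measurable fun ω => assessor γl γr (ξ ω) (X i ω) (uValue (Z i ω)) := by
  have h : Continuous fun y : Param p × (Fin p → ℝ) × ℝ =>
      assessor γl γr y.1 y.2.1 (uValue y.2.2) :=
    continuous_assessor_uValue hγl hγr continuous_fst continuous_snd.fst continuous_snd.snd
  exact measurable_comp_triple h hξ hX hZ i

theorem measurableSet_mirror_le (hγl : 2 < γl) (hγr : 2 < γr) (hξ : Measurable ξ)
    (hX : ∀ i, Measurable (X i)) (hZ : ∀ i, Measurable (Z i)) (i : ℕ) {t : ℝ}
    (ht : t ∈ Set.Icc (0 : ℝ) 1) :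
    MeasurableSet {ω | mirror γl γr (ξ ω) (X i ω) (uValue (Z i ω)) ≤ t} := by
  simp only [mirror_le_iff hγl hγr _ _ ht]
  have h1 : Continuous fun y : Param p × (Fin p → ℝ) × ℝ =>
      1 - sStat γl γr y.1 y.2.1 (uValue y.2.2) :=
    continuous_const.sub (continuous_sStat_uValue hγl hγr continuous_fst continuous_snd.fst
      continuous_snd.snd)
  have h2 : Continuous fun y : Param p × (Fin p → ℝ) × ℝ => nullCDF γl γr y.1 y.2.1 t :=
    continuous_nullCDF hγl hγr continuous_fst continuous_snd.fst continuous_const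
  exact measurableSet_le (measurable_comp_triple h1 hξ hX hZ i)
    (measurable_comp_triple h2 hξ hX hZ i)

theorem measurable_card_filter {A : Ω → ℕ → Prop} [∀ ω, DecidablePred (A ω)] (s : Finset ℕ)
    (hA : ∀ i, MeasurableSet {ω | A ω i}) : Measurable fun ω => (s.filter (A ω)).card := by
  classical
  simp only [Finset.card_filter]
  exact Finset.measurable_sum _ fun i _ => Measurable.ite (hA i) measurable_const measurable_const

theorem measurable_fdpHat (hγl : 2 < γl) (hγr : 2 < γr) (hξ : Measurable ξ)
    (hX : ∀ i, Measurable (X i)) (hZ : ∀ i, Measurable (Z i)) (m : ℕ) {t : ℝ}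
    (ht : t ∈ Set.Icc (0 : ℝ) 1) :
    Measurable fun ω => fdpHat γl γr (ξ ω) (fun i => X i ω) (fun i => uValue (Z i ω)) m t := by
  have hcast : Measurable fun n : ℕ => (n : ℝ) := measurable_from_nat
  have h1 := measurable_card_filter
    (A := fun ω i => mirror γl γr (ξ ω) (X i ω) (uValue (Z i ω)) ≤ t) (Finset.range m)
    fun i => measurableSet_mirror_le hγl hγr hξ hX hZ i ht
  have h2 := measurable_card_filter
    (A := fun ω i => assessor γl γr (ξ ω) (X i ω) (uValue (Z i ω)) ≤ t) (Finset.range m)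
    fun i => measurableSet_le (measurable_assessor hγl hγr hξ hX hZ i) measurable_const
  unfold fdpHat
  exact (measurable_const.add (hcast.comp h1)).div (hcast.comp (h2.max measurable_const))

/-- The estimated false discovery proportion is a right-continuous step function. -/
theorem eventually_fdpHat_eq (ξ : Param p) (x : ℕ → Fin p → ℝ) (u : ℕ → ℝ) (m : ℕ) (t : ℝ) :
    ∀ᶠ s in 𝓝[>] t, fdpHat γl γr ξ x u m s = fdpHat γl γr ξ x u m t := by
  have h : ∀ a : ℝ, ∀ᶠ s in 𝓝[>] t, (a ≤ s ↔ a ≤ t) := fun a => by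
    rcases le_or_gt a t with hat | hat
    · filter_upwards [self_mem_nhdsWithin] with s hs
      exact iff_of_true (hat.trans (Set.mem_Ioi.1 hs).le) hat
    · filter_upwards [nhdsWithin_le_nhds (eventually_lt_nhds hat)] with s hs
      exact iff_of_false (not_le.2 hs) (not_le.2 hat)
  have h1 := (Filter.eventually_all_finset (Finset.range m)).2 fun i _ =>
    h (mirror γl γr ξ (x i) (u i))
  have h2 := (Filter.eventually_all_finset (Finset.range m)).2 fun i _ =>
    h (assessor γl γr ξ (x i) (u i))
  filter_upwards [h1, h2] with s hs1 hs2
  unfold fdpHat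
  rw [Finset.filter_congr hs1, Finset.filter_congr hs2]

theorem bddAbove_fdpHat_le (α : ℝ) (ξ : Param p) (x : ℕ → Fin p → ℝ) (u : ℕ → ℝ) (m : ℕ) :
    BddAbove {t : ℝ | t ∈ Set.Icc (0 : ℝ) 1 ∧ fdpHat γl γr ξ x u m t ≤ α} :=
  ⟨1, fun _ ht => ht.1.2⟩

open Classical in
/-- The threshold is a supremum over rational candidates. -/
theorem isLUB_threshold (α : ℝ) (ξ : Param p) (x : ℕ → Fin p → ℝ) (u : ℕ → ℝ) (m : ℕ) :
    IsLUB {a : ℝ | ∃ q : {q : ℚ // (q : ℝ) ∈ Set.Icc (0 : ℝ) 1},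
      (if fdpHat γl γr ξ x u m (q : ℚ) ≤ α then ((q : ℚ) : ℝ) else 0) = a}
      (threshold γl γr α ξ x u m) := by
  have hnonneg : 0 ≤ threshold γl γr α ξ x u m := Real.sSup_nonneg fun t ht => ht.1.1
  refine ⟨?_, fun b hb => ?_⟩
  · rintro _ ⟨q, rfl⟩
    split_ifs with h
    · exact le_csSup (bddAbove_fdpHat_le α ξ x u m) ⟨q.2, h⟩
    · exact hnonneg
  -- The candidate `q = 0` contributes `0` in either branch; this also covers the case where no
  -- threshold qualifies.
  · have hb0 : 0 ≤ b := hb ⟨⟨0, by simp⟩, by simp⟩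
    refine Real.sSup_le (fun t ht => ?_) hb0
    -- Below `1`, right-continuity supplies a rational just above `t` with the same estimated
    -- proportion; `t = 1` is itself rational.
    rcases ht.1.2.lt_or_eq with h1 | rfl
    · obtain ⟨c, hc, hct⟩ := mem_nhdsGT_iff_exists_Ioo_subset.1
        (eventually_fdpHat_eq (γl := γl) (γr := γr) ξ x u m t)
      obtain ⟨q, hq1, hq2⟩ := exists_rat_btwn (lt_min hc h1)
      have hq : (q : ℝ) ∈ Set.Icc (0 : ℝ) 1 :=
        ⟨ht.1.1.trans hq1.le, (hq2.trans_le (min_le_right _ _)).le⟩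
      have he : fdpHat γl γr ξ x u m q = fdpHat γl γr ξ x u m t :=
        hct ⟨hq1, hq2.trans_le (min_le_left _ _)⟩
      exact hq1.le.trans (hb ⟨⟨q, hq⟩, by rw [if_pos]; simpa only [he] using ht.2⟩)
    · exact hb ⟨⟨1, by simp⟩, by rw [if_pos] <;> simp [ht.2]⟩

theorem measurable_threshold (hγl : 2 < γl) (hγr : 2 < γr) (α : ℝ) (hξ : Measurable ξ)
    (hX : ∀ i, Measurable (X i)) (hZ : ∀ i, Measurable (Z i)) (m : ℕ) :
    Measurable fun ω =>
      threshold γl γr α (ξ ω) (fun i => X i ω) (fun i => uValue (Z i ω)) m := by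
  classical
  refine Measurable.isLUB (f := fun (q : {q : ℚ // (q : ℝ) ∈ Set.Icc (0 : ℝ) 1}) ω =>
    if fdpHat γl γr (ξ ω) (fun i => X i ω) (fun i => uValue (Z i ω)) m (q : ℚ) ≤ α
      then ((q : ℚ) : ℝ) else 0) (fun q => ?_) fun ω => isLUB_threshold α _ _ _ m
  exact Measurable.ite (measurableSet_le (measurable_fdpHat hγl hγr hξ hX hZ m q.2)
    measurable_const) measurable_const measurable_const

theorem measurable_zapFDP (hγl : 2 < γl) (hγr : 2 < γr) (α : ℝ) {H : ℕ → Ω → Bool}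
    (hH : ∀ i, Measurable (H i)) (hX : ∀ i, Measurable (X i)) (hZ : ∀ i, Measurable (Z i))
    {est : ℕ → Ω → Param p} {m : ℕ} (hest : Measurable (est m)) :
    Measurable (zapFDP γl γr α H Z X est m) := by
  have hcast : Measurable fun n : ℕ => (n : ℝ) := measurable_from_nat
  have hrej : ∀ i, MeasurableSet {ω | assessor γl γr (est m ω) (X i ω) (uValue (Z i ω)) ≤
      threshold γl γr α (est m ω) (fun i => X i ω) (fun i => uValue (Z i ω)) m} := fun i =>
    measurableSet_le (measurable_assessor hγl hγr hest hX hZ i)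
      (measurable_threshold hγl hγr α hest hX hZ m)
  unfold zapFDP fdp rejected
  simp only [Finset.filter_filter]
  exact (hcast.comp (measurable_card_filter
    (A := fun ω i => assessor γl γr (est m ω) (X i ω) (uValue (Z i ω)) ≤
      threshold γl γr α (est m ω) (fun i => X i ω) (fun i => uValue (Z i ω)) m ∧ H i ω = false) _
    fun i => (hrej i).inter (hH i (measurableSet_singleton false)))).div
    (hcast.comp ((measurable_card_filter _ hrej).max measurable_const))

theorem fdp_nonneg (h : ℕ → Bool) (R : Finset ℕ) : 0 ≤ fdp h R := by unfold fdp; positivity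

theorem fdp_le_one (h : ℕ → Bool) (R : Finset ℕ) : fdp h R ≤ 1 := by
  unfold fdp
  refine div_le_one_of_le₀ ?_ (by positivity)
  exact_mod_cast (Finset.card_filter_le _ _).trans (le_max_left _ _)

end Measurability

/-! ## Consistency of the maximum likelihood estimator -/

section Consistency

variable {p : ℕ} {γl γr : ℝ}

theorem hL_le (hγl : 1 ≤ γl) (β : Coef p × Coef p) (x : Fin p → ℝ) {u : ℝ}
    (hu : u ∈ Set.Ioo (0 : ℝ) 1) : hL γl β x u ≤ 1 / beta (shape β.1 x) γl * u⁻¹ := by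
  have hk := shape_pos β.1 x
  have hB : 0 < 1 / beta (shape β.1 x) γl := one_div_pos.2 (beta_pos hk (by linarith))
  have e : hL γl β x u = 1 / beta (shape β.1 x) γl * u ^ (shape β.1 x - 1) *
    (1 - u) ^ (γl - 1) := if_pos hu
  have h1 : u ^ (shape β.1 x - 1) ≤ u⁻¹ := by
    rw [← Real.rpow_neg_one]
    exact Real.rpow_le_rpow_of_exponent_ge hu.1 hu.2.le (by linarith)
  have h2 : (1 - u) ^ (γl - 1) ≤ 1 :=
    Real.rpow_le_one (by linarith [hu.2]) (by linarith [hu.1]) (by linarith)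
  have h3 : 0 ≤ u⁻¹ := inv_nonneg.2 hu.1.le
  rw [e]
  calc _ ≤ 1 / beta (shape β.1 x) γl * u ^ (shape β.1 x - 1) * 1 :=
        mul_le_mul_of_nonneg_left h2 (mul_nonneg hB.le (Real.rpow_nonneg hu.1.le _))
    _ ≤ _ := by rw [mul_one]; exact mul_le_mul_of_nonneg_left h1 hB.le

theorem hR_le (hγr : 1 ≤ γr) (β : Coef p × Coef p) (x : Fin p → ℝ) {u : ℝ}
    (hu : u ∈ Set.Ioo (0 : ℝ) 1) : hR γr β x u ≤ 1 / beta (shape β.2 x) γr * (1 - u)⁻¹ := by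
  have h := hL_le hγr (β.2, β.1) x (u := 1 - u) ⟨by linarith [hu.2], by linarith [hu.1]⟩
  rw [hL, betaPDFReal_one_sub] at h
  exact h

/-- An envelope for the log-likelihood that is uniform in the parameter. From below, the density
exceeds the null weight, which is bounded away from zero by compactness. From above, the beta
densities have singularities no worse than `1/u` and `1/(1-u)`. The logarithmic terms are integrable
by assumption. -/
theorem abs_log_mixDensity_le (hγl : 1 ≤ γl) (hγr : 1 ≤ γr) {K : Set (Param p)}
    (hK : IsCompact K) (C : ℝ) : ∃ A : ℝ, ∀ ξ ∈ K, ∀ x : Fin p → ℝ, ‖x‖ ≤ C →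
      ∀ u ∈ Set.Ioo (0 : ℝ) 1,
        |Real.log (mixDensity γl γr ξ x u)| ≤ A + |Real.log u| + |Real.log (1 - u)| := by
  have hl : 0 < γl := by linarith
  have hr : 0 < γr := by linarith
  have hKC : IsCompact (K ×ˢ Metric.closedBall (0 : Fin p → ℝ) C) :=
    hK.prod (isCompact_closedBall _ _)
  have hθ : Continuous fun y : Param p × (Fin p → ℝ) => y.1.1 := by fun_prop
  have hx : Continuous fun y : Param p × (Fin p → ℝ) => y.2 := by fun_prop
  have hc1 : Continuous fun y : Param p × (Fin p → ℝ) =>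
      Real.log (1 - piL y.1.1 y.2 - piR y.1.1 y.2) :=
    ((continuous_const.sub (continuous_piL hθ hx)).sub (continuous_piR hθ hx)).log
      fun y => (piNull_pos _ _).ne'
  have hc2 : Continuous fun y : Param p × (Fin p → ℝ) =>
      1 / beta (shape y.1.2.1 y.2) γl + 1 / beta (shape y.1.2.2 y.2) γr :=
    (continuous_const.div (continuous_beta (continuous_shape (by fun_prop) hx) continuous_const
      (fun y => shape_pos _ _) fun _ => hl) fun y => (beta_pos (shape_pos _ _) hl).ne').add
    (continuous_const.div (continuous_beta (continuous_shape (by fun_prop) hx) continuous_const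
      (fun y => shape_pos _ _) fun _ => hr) fun y => (beta_pos (shape_pos _ _) hr).ne')
  obtain ⟨A, hA⟩ := hKC.exists_bound_of_continuousOn hc1.continuousOn
  obtain ⟨b, hb⟩ := hKC.exists_bound_of_continuousOn hc2.continuousOn
  refine ⟨max A (Real.log (1 + b)), fun ξ hξ x hxC u hu => ?_⟩
  have hmem : (ξ, x) ∈ K ×ˢ Metric.closedBall (0 : Fin p → ℝ) C :=
    ⟨hξ, mem_closedBall_zero_iff.2 hxC⟩
  have h1 := hA _ hmem
  have h2 := (Real.le_norm_self _).trans (hb _ hmem)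
  rw [Real.norm_eq_abs, abs_le] at h1
  simp only at h1 h2
  have hB1 : 0 < 1 / beta (shape ξ.2.1 x) γl := one_div_pos.2 (beta_pos (shape_pos _ _) hl)
  have hB2 : 0 < 1 / beta (shape ξ.2.2 x) γr := one_div_pos.2 (beta_pos (shape_pos _ _) hr)
  have hu1 : 0 < 1 - u := sub_pos.2 hu.2
  have hlow := Real.log_le_log (piNull_pos ξ.1 x) (piNull_lt_mixDensity hl hr ξ x hu).le
  have hup : mixDensity γl γr ξ x u ≤ (1 + b) / (u * (1 - u)) := by
    have e1 := hL_le hγl ξ.2 x hu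
    have e2 := hR_le hγr ξ.2 x hu
    have p1 := piL_pos ξ.1 x
    have p2 := piR_pos ξ.1 x
    have p3 := piNull_pos ξ.1 x
    have f1 : 0 < hL γl ξ.2 x u := betaPDFReal_pos hu.1 hu.2 (shape_pos _ _) hl
    have f2 : 0 < hR γr ξ.2 x u := betaPDFReal_pos hu.1 hu.2 hr (shape_pos _ _)
    have g1 : piL ξ.1 x * hL γl ξ.2 x u ≤ hL γl ξ.2 x u :=
      mul_le_of_le_one_left f1.le (by linarith)
    have g2 : piR ξ.1 x * hR γr ξ.2 x u ≤ hR γr ξ.2 x u :=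
      mul_le_of_le_one_left f2.le (by linarith)
    have k1 : u⁻¹ ≤ (u * (1 - u))⁻¹ :=
      inv_anti₀ (mul_pos hu.1 hu1) (mul_le_of_le_one_right hu.1.le (by linarith [hu.1]))
    have k2 : (1 - u)⁻¹ ≤ (u * (1 - u))⁻¹ :=
      inv_anti₀ (mul_pos hu.1 hu1) (mul_le_of_le_one_left hu1.le hu.2.le)
    have k3 : 1 ≤ (u * (1 - u))⁻¹ :=
      (one_le_inv₀ (mul_pos hu.1 hu1)).2 (mul_le_one₀ hu.2.le hu1.le (by linarith [hu.1]))
    have m1 := mul_le_mul_of_nonneg_left k1 hB1.le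
    have m2 := mul_le_mul_of_nonneg_left k2 hB2.le
    have m3 := mul_le_mul_of_nonneg_right h2 (zero_le_one.trans k3)
    rw [div_eq_mul_inv]
    unfold mixDensity
    linarith
  have hb0 : 0 < 1 + b := by linarith
  have hlog := Real.log_le_log (mixDensity_pos hl hr ξ x hu) hup
  rw [Real.log_div hb0.ne' (mul_pos hu.1 hu1).ne', Real.log_mul hu.1.ne' hu1.ne'] at hlog
  rw [abs_le]
  have a1 := abs_nonneg (Real.log u)
  have a2 := abs_nonneg (Real.log (1 - u))
  have a3 := neg_abs_le (Real.log u)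
  have a4 := neg_abs_le (Real.log (1 - u))
  have a5 := le_max_left A (Real.log (1 + b))
  have a6 := le_max_right A (Real.log (1 + b))
  constructor <;> linarith

variable {Ω : Type*} [MeasurableSpace Ω] {P : Measure Ω} [IsProbabilityMeasure P]
  {H : ℕ → Ω → Bool} {Z : ℕ → Ω → ℝ} {X : ℕ → Ω → Fin p → ℝ}

/-- The maximum likelihood estimator agrees with a strongly consistent sequence in the parameter
set. -/
theorem exists_tendsto_eq_est (hmodel : TwoGroupModel P H Z X) (hγl : 2 < γl) (hγr : 2 < γr)
    {Θ B : Set (Coef p × Coef p)} {ξstar : Param p}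
    (hmax : UniqueMaximizer P γl γr Z X Θ B ξstar) (hreg : Regularity P Z X)
    {est : ℕ → Ω → Param p} (hest : IsMLE P γl γr Z X Θ B est) :
    ∃ q : ℕ → Ω → ↥(Θ ×ˢ B), (∀ᵐ ω ∂P, ∀ m, (q m ω : Param p) = est m ω) ∧
      ∀ᵐ ω ∂P, Tendsto (fun m => q m ω) atTop (𝓝 ⟨ξstar, hmax.mem⟩) := by
  classical
  have hK : IsCompact (Θ ×ˢ B) := hmax.compact_theta.prod hmax.compact_beta
  have : CompactSpace ↥(Θ ×ˢ B) := isCompact_iff_compactSpace.1 hK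
  have hg : Continuous fun y : (Bool × ℝ × (Fin p → ℝ)) × ↥(Θ ×ˢ B) =>
      Real.log (mixDensity γl γr y.2 y.1.2.2 (uValue y.1.2.1)) :=
    (continuous_mixDensity (by linarith) (by linarith) (by fun_prop) (by fun_prop)
      (continuous_uValue.comp (by fun_prop)) fun _ => uValue_mem _).log
      fun y => (mixDensity_pos (by linarith) (by linarith) _ _ (uValue_mem _)).ne'
  obtain ⟨C, hC⟩ := hreg.bounded
  obtain ⟨A, hA⟩ := abs_log_mixDensity_le (γl := γl) (γr := γr) (by linarith) (by linarith) hK C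
  obtain ⟨F, hF, hlim⟩ := uniform_strong_law (W := fun i ω => (H i ω, Z i ω, X i ω))
    (fun i => (hmodel.measurable_H i).prodMk ((hmodel.measurable_Z i).prodMk
      (hmodel.measurable_X i))) hmodel.indep hmodel.identDistrib ⟨_, hg⟩
    (M := fun ω => A + |Real.log (uValue (Z 0 ω))| + |Real.log (1 - uValue (Z 0 ω))|)
    (((integrable_const A).add hreg.integrable_log.abs).add hreg.integrable_log_one_sub.abs)
    (by
      filter_upwards [hC] with ω hω q
      exact hA q q.2 _ (hω 0) _ (uValue_mem _))
  have hF' : ∀ q : ↥(Θ ×ˢ B), F q = expLogLik P γl γr Z X q := hF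
  let q₀ : ↥(Θ ×ˢ B) := ⟨ξstar, hmax.mem⟩
  -- The default `q₀` is used only on a null set; it lets the sequence live in the compact subtype.
  refine ⟨fun m ω => if h : est m ω ∈ Θ ×ˢ B then ⟨est m ω, h⟩ else q₀, ?_, ?_⟩
  · filter_upwards [ae_all_iff.2 hest.isMax] with ω hω m
    rw [dif_pos (hω m).1]
  · filter_upwards [ae_all_iff.2 hest.isMax, hlim] with ω hω hlimω
    refine tendsto_of_isMaxOn hlimω (q₀ := q₀) (fun q hq => ?_) fun n => ?_
    · rw [hF', hF']
      exact hmax.lt_max q q.2 fun h => hq (Subtype.ext h)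
    · have h := (hω n).2 hmax.mem
      rw [dif_pos (hω n).1]
      have e : ∀ q : ↥(Θ ×ˢ B), ((n : ℝ)⁻¹ • ∑ i ∈ Finset.range n,
          (ContinuousMap.mk _ hg).curry (H i ω, Z i ω, X i ω)) q =
          (n : ℝ)⁻¹ * logLik γl γr (fun i => X i ω) (fun i => uValue (Z i ω)) n q := fun q => by
        simp [logLik]
      rw [e, e]
      exact mul_le_mul_of_nonneg_left h (by positivity)

end Consistency

/-! ## Continuous surrogates for indicators -/

section Ramp

/-- The piecewise linear function that rises from `0` to `1` on `[0, ε]`. -/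
def ramp (ε y : ℝ) : ℝ := max 0 (min 1 (y / ε))

theorem continuous_ramp (ε : ℝ) : Continuous (ramp ε) := by unfold ramp; fun_prop

theorem ramp_nonneg (ε y : ℝ) : 0 ≤ ramp ε y := le_max_left _ _

theorem ramp_le_one (ε y : ℝ) : ramp ε y ≤ 1 := max_le zero_le_one (min_le_left _ _)

theorem ramp_of_le {ε y : ℝ} (hε : 0 < ε) (h : ε ≤ y) : ramp ε y = 1 := by
  rw [ramp, min_eq_left ((one_le_div hε).2 h), max_eq_right zero_le_one]

theorem ramp_of_nonpos {ε y : ℝ} (hε : 0 < ε) (h : y ≤ 0) : ramp ε y = 0 :=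
  max_eq_left ((min_le_right _ _).trans (div_nonpos_of_nonpos_of_nonneg h hε.le))

variable {S : Type*} [MeasurableSpace S] {μ : Measure S} [IsProbabilityMeasure μ]

theorem integrable_ramp {ε : ℝ} {f : S → ℝ} (hf : Measurable f) :
    Integrable (fun s => ramp ε (f s)) μ :=
  (integrable_const (1 : ℝ)).mono' ((continuous_ramp ε).measurable.comp hf).aestronglyMeasurable
    (Eventually.of_forall fun s => by
      rw [Real.norm_eq_abs, abs_of_nonneg (ramp_nonneg _ _)]; exact ramp_le_one _ _)

/-- The ramp lies between the indicators of `[ε, ∞)` and `[0, ∞)`. This bound and the next one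
convert between ramps and probabilities at the cost of a shift by `ε`. -/
theorem integral_ramp_le {ε : ℝ} (hε : 0 < ε) {f : S → ℝ} (hf : Measurable f) :
    ∫ s, ramp ε (f s) ∂μ ≤ μ.real {s | 0 ≤ f s} := by
  have hm : MeasurableSet {s | 0 ≤ f s} := measurableSet_le measurable_const hf
  rw [← integral_indicator_one hm]
  refine integral_mono (integrable_ramp hf)
    ((integrable_indicator_iff hm).2 (integrable_const (1 : ℝ)).integrableOn) fun s => ?_
  by_cases h : s ∈ {s | 0 ≤ f s}
  · simpa [Set.indicator_of_mem h] using ramp_le_one ε (f s)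
  · simp [Set.indicator_of_notMem h, ramp_of_nonpos hε (not_le.1 h).le]

theorem le_integral_ramp {ε : ℝ} (hε : 0 < ε) {f : S → ℝ} (hf : Measurable f) :
    μ.real {s | ε ≤ f s} ≤ ∫ s, ramp ε (f s) ∂μ := by
  have hm : MeasurableSet {s | ε ≤ f s} := measurableSet_le measurable_const hf
  rw [← integral_indicator_one hm]
  refine integral_mono ((integrable_indicator_iff hm).2 (integrable_const (1 : ℝ)).integrableOn)
    (integrable_ramp hf) fun s => ?_
  by_cases h : s ∈ {s | ε ≤ f s}
  · simp [Set.indicator_of_mem h, ramp_of_le hε h]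
  · simpa [Set.indicator_of_notMem h] using ramp_nonneg ε (f s)

/-- Continuity from above along `ε = 1/(n+1)`: enlarging a closed event slightly is cheap, even if
`f` has an atom at `0`. -/
theorem exists_measureReal_neg_le_lt {f : S → ℝ} (hf : Measurable f) {η : ℝ} (hη : 0 < η) :
    ∃ ε > 0, μ.real {s | -ε ≤ f s} < μ.real {s | 0 ≤ f s} + η := by
  have hanti : Antitone fun n : ℕ => {s | -(1 / ((n : ℝ) + 1)) ≤ f s} := fun m n hmn s hs => by
    simp only [Set.mem_ofPred_eq] at hs ⊢
    exact (neg_le_neg (Nat.one_div_le_one_div hmn)).trans hs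
  have h := tendsto_measure_iInter_atTop (μ := μ)
    (fun n => (measurableSet_le measurable_const hf).nullMeasurableSet) hanti
    ⟨0, measure_ne_top _ _⟩
  have e : ⋂ n : ℕ, {s | -(1 / ((n : ℝ) + 1)) ≤ f s} = {s | 0 ≤ f s} := by
    ext s
    simp only [Set.mem_iInter, Set.mem_ofPred_eq]
    refine ⟨fun hs => ?_, fun hs n => (neg_nonpos.2 (by positivity)).trans hs⟩
    have hl := (tendsto_one_div_add_atTop_nhds_zero_nat (𝕜 := ℝ)).neg
    rw [neg_zero] at hl
    exact le_of_tendsto' hl hs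
  rw [e] at h
  have h' := (ENNReal.tendsto_toReal (measure_ne_top μ {s | 0 ≤ f s})).comp h
  obtain ⟨n, hn⟩ := (h'.eventually_lt_const
    (show (μ {s | 0 ≤ f s}).toReal < μ.real {s | 0 ≤ f s} + η from
      lt_add_of_pos_right _ hη)).exists
  exact ⟨1 / ((n : ℝ) + 1), by positivity, hn⟩

end Ramp

/-! ## The distribution of the null statistics -/

section NullLaw

variable {Ω : Type*} [MeasurableSpace Ω] {P : Measure Ω} [IsProbabilityMeasure P] {p : ℕ}
  {γl γr : ℝ} {H : ℕ → Ω → Bool} {Z : ℕ → Ω → ℝ} {X : ℕ → Ω → Fin p → ℝ}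

/-- Given a true null, the covariate is independent of the standard normal test statistic. -/
theorem map_restrict_null (hmodel : TwoGroupModel P H Z X) :
    (P.restrict {ω | H 0 ω = false}).map (fun ω => (X 0 ω, Z 0 ω)) =
      ((P.restrict {ω | H 0 ω = false}).map (X 0)).prod (gaussianReal 0 1) := by
  symm
  refine Measure.prod_eq fun B A hB hA => ?_
  rw [Measure.map_apply ((hmodel.measurable_X 0).prodMk (hmodel.measurable_Z 0)) (hB.prod hA),
    Measure.map_apply (hmodel.measurable_X 0) hB,
    Measure.restrict_apply (((hmodel.measurable_X 0).prodMk (hmodel.measurable_Z 0)) (hB.prod hA)),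
    Measure.restrict_apply (hmodel.measurable_X 0 hB)]
  convert hmodel.null_law 0 A B hA hB using 2
  · ext ω; simp only [Set.mem_inter_iff, Set.mem_preimage, Set.mem_prod, Set.mem_ofPred_eq]; tauto
  · congr 1; ext ω; simp only [Set.mem_inter_iff, Set.mem_preimage, Set.mem_ofPred_eq]; tauto

/-- Fubini for the product law of `map_restrict_null`: on the nulls, the test statistic is
integrated out with the covariate held fixed. -/
theorem setIntegral_null (hmodel : TwoGroupModel P H Z X) {φ : (Fin p → ℝ) × ℝ → ℝ}
    (hφ : Continuous φ) (h01 : ∀ y, φ y ∈ Set.Icc (0 : ℝ) 1) :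
    Integrable (fun ω => ∫ z, φ (X 0 ω, z) ∂(gaussianReal 0 1)) P ∧
    ∫ ω in {ω | H 0 ω = false}, φ (X 0 ω, Z 0 ω) ∂P =
      ∫ ω in {ω | H 0 ω = false}, ∫ z, φ (X 0 ω, z) ∂(gaussianReal 0 1) ∂P := by
  have hX := hmodel.measurable_X 0
  have hXZ := hX.prodMk (hmodel.measurable_Z 0)
  have hbound : ∀ y, ‖φ y‖ ≤ 1 := fun y => by
    rw [Real.norm_eq_abs, abs_of_nonneg (h01 y).1]; exact (h01 y).2
  have hsm : StronglyMeasurable fun x => ∫ z, φ (x, z) ∂(gaussianReal 0 1) :=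
    hφ.stronglyMeasurable.integral_prod_right'
  refine ⟨(integrable_const (1 : ℝ)).mono' (hsm.comp_measurable hX).aestronglyMeasurable
    (Eventually.of_forall fun ω => ?_), ?_⟩
  · refine (norm_integral_le_of_norm_le_const (C := 1)
      (Eventually.of_forall fun z => hbound _)).trans ?_
    simp
  · have e1 := integral_map (μ := P.restrict {ω | H 0 ω = false}) hXZ.aemeasurable
      (f := φ) hφ.aestronglyMeasurable
    rw [← e1, map_restrict_null hmodel, integral_prod]
    · exact integral_map hX.aemeasurable hsm.aestronglyMeasurable
    · exact (integrable_const (1 : ℝ)).mono' hφ.aestronglyMeasurable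
        (Eventually.of_forall hbound)

/-- The probability `P(H = 0, T ≤ t)`, as the mean of the null distribution function. -/
def nullMass (P : Measure Ω) (γl γr : ℝ) (H : ℕ → Ω → Bool) (X : ℕ → Ω → Fin p → ℝ)
    (ξ : Param p) (t : ℝ) : ℝ :=
  ∫ ω in {ω | H 0 ω = false}, nullCDF γl γr ξ (X 0 ω) t ∂P

theorem integrable_nullCDF (hmodel : TwoGroupModel P H Z X) (hγl : 2 < γl) (hγr : 2 < γr)
    (ξ : Param p) (t : ℝ) : Integrable (fun ω => nullCDF γl γr ξ (X 0 ω) t) P :=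
  (integrable_const (1 : ℝ)).mono'
    ((continuous_nullCDF hγl hγr continuous_const continuous_id
      continuous_const).measurable.comp (hmodel.measurable_X 0)).aestronglyMeasurable
    (Eventually.of_forall fun ω => by
      rw [Real.norm_eq_abs, abs_of_nonneg (nullCDF_nonneg _ _ _)]; exact nullCDF_le_one _ _ _)

theorem continuous_nullMass (hmodel : TwoGroupModel P H Z X) (hγl : 2 < γl) (hγr : 2 < γr)
    (ξ : Param p) : Continuous (nullMass P γl γr H X ξ) := by
  refine continuous_of_dominated (bound := fun _ => 1)
    (fun t => (integrable_nullCDF hmodel hγl hγr ξ t).integrableOn.aestronglyMeasurable)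
    (fun t => Eventually.of_forall fun ω => ?_) (integrable_const _)
    (Eventually.of_forall fun ω =>
      continuous_nullCDF hγl hγr continuous_const continuous_const continuous_id)
  rw [Real.norm_eq_abs, abs_of_nonneg (nullCDF_nonneg _ _ _)]
  exact nullCDF_le_one _ _ _

/-- The ramp vanishes for `T ≥ t + ε`, and given the covariate a null has `T ≤ t + ε` with
probability `c_X(t + ε)`. -/
theorem setIntegral_ramp_assessor_le (hmodel : TwoGroupModel P H Z X) (hγl : 2 < γl)
    (hγr : 2 < γr) (ξ : Param p) {ε : ℝ} (hε : 0 < ε) (t : ℝ) :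
    ∫ ω in {ω | H 0 ω = false},
        ramp ε (t + ε - assessor γl γr ξ (X 0 ω) (uValue (Z 0 ω))) ∂P ≤
      nullMass P γl γr H X ξ (t + ε) := by
  have hc : Continuous fun y : (Fin p → ℝ) × ℝ =>
      t + ε - assessor γl γr ξ y.1 (uValue y.2) :=
    continuous_const.sub (continuous_assessor_uValue hγl hγr continuous_const continuous_fst
      continuous_snd)
  obtain ⟨hi, he⟩ := setIntegral_null hmodel ((continuous_ramp ε).comp hc)
    fun y => ⟨ramp_nonneg _ _, ramp_le_one _ _⟩
  refine he.trans_le (setIntegral_mono hi.integrableOn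
    (integrable_nullCDF hmodel hγl hγr ξ _).integrableOn fun ω => ?_)
  rw [← gaussianReal_assessor_le (by linarith) (by linarith)]
  refine (integral_ramp_le hε (hc.comp (Continuous.prodMk_right (X 0 ω))).measurable).trans_eq ?_
  simp

/-- The mirror side of the null symmetry. By `gaussianReal_sStat_lt_le`, a null has `S ≥ 1 - c_X(t)
+ ε` with conditional probability at least `c_X(t) - ε`, and the ramp equals `1` there. -/
theorem le_setIntegral_ramp_sStat (hmodel : TwoGroupModel P H Z X) (hγl : 2 < γl)
    (hγr : 2 < γr) (ξ : Param p) {ε : ℝ} (hε : 0 < ε) (t : ℝ) :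
    nullMass P γl γr H X ξ t - ε ≤
      ∫ ω in {ω | H 0 ω = false},
        ramp ε (sStat γl γr ξ (X 0 ω) (uValue (Z 0 ω)) - (1 - nullCDF γl γr ξ (X 0 ω) t)) ∂P := by
  have hc : Continuous fun y : (Fin p → ℝ) × ℝ =>
      sStat γl γr ξ y.1 (uValue y.2) - (1 - nullCDF γl γr ξ y.1 t) :=
    (continuous_sStat_uValue hγl hγr continuous_const continuous_fst continuous_snd).sub
      (continuous_const.sub
        (continuous_nullCDF hγl hγr continuous_const continuous_fst continuous_const))
  obtain ⟨hi, he⟩ := setIntegral_null hmodel ((continuous_ramp ε).comp hc)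
    fun y => ⟨ramp_nonneg _ _, ramp_le_one _ _⟩
  have hle : nullMass P γl γr H X ξ t - ε ≤
      ∫ ω in {ω | H 0 ω = false}, (nullCDF γl γr ξ (X 0 ω) t - ε) ∂P := by
    rw [integral_sub (integrable_nullCDF hmodel hγl hγr ξ _).integrableOn (integrable_const _),
      setIntegral_const, smul_eq_mul, nullMass]
    have : P.real {ω | H 0 ω = false} * ε ≤ 1 * ε :=
      mul_le_mul_of_nonneg_right measureReal_le_one hε.le
    linarith
  refine hle.trans ((setIntegral_mono
    ((integrable_nullCDF hmodel hγl hγr ξ _).sub (integrable_const _)).integrableOn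
    hi.integrableOn fun ω => ?_).trans_eq he.symm)
  simp only [Function.comp_apply]
  have hf : Continuous fun z => sStat γl γr ξ (X 0 ω) (uValue z) -
      (1 - nullCDF γl γr ξ (X 0 ω) t) :=
    (continuous_sStat_uValue hγl hγr continuous_const continuous_const continuous_id).sub
      continuous_const
  -- If `c_X(t) ≤ ε` the bound is trivial; otherwise the level `1 - c_X(t) + ε` lies in `[0,1]`, as
  -- the bound on `S` requires.
  rcases le_or_gt (nullCDF γl γr ξ (X 0 ω) t) ε with h | h
  · exact (sub_nonpos.2 h).trans (integral_nonneg fun z => ramp_nonneg _ _)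
  · change nullCDF γl γr ξ (X 0 ω) t - ε ≤ _
    refine le_trans ?_ (le_integral_ramp hε hf.measurable)
    have h1 := nullCDF_le_one (γl := γl) (γr := γr) ξ (X 0 ω) t
    have hs := gaussianReal_sStat_lt_le hγl hγr ξ (X 0 ω)
      (s := 1 - nullCDF γl γr ξ (X 0 ω) t + ε) ⟨by linarith, by linarith⟩
    have hcompl : {z | ε ≤ sStat γl γr ξ (X 0 ω) (uValue z) -
        (1 - nullCDF γl γr ξ (X 0 ω) t)} =
        {z | sStat γl γr ξ (X 0 ω) (uValue z) < 1 - nullCDF γl γr ξ (X 0 ω) t + ε}ᶜ := by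
      ext z
      simp only [Set.mem_ofPred_eq, Set.mem_compl_iff, not_lt, le_sub_iff_add_le]
      rw [add_comm]
    have hm : MeasurableSet
        {z | sStat γl γr ξ (X 0 ω) (uValue z) < 1 - nullCDF γl γr ξ (X 0 ω) t + ε} :=
      measurableSet_lt (continuous_sStat_uValue hγl hγr continuous_const continuous_const
        continuous_id).measurable measurable_const
    rw [hcompl, probReal_compl_eq_one_sub hm]
    linarith

end NullLaw

/-! ## Uniform bounds for the empirical frequencies -/

section Frequencies

theorem card_filter_le_sum {A : ℕ → Prop} [DecidablePred A] {s : Finset ℕ} {g : ℕ → ℝ}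
    (h0 : ∀ i, 0 ≤ g i) (h1 : ∀ i, A i → 1 ≤ g i) : ((s.filter A).card : ℝ) ≤ ∑ i ∈ s, g i := by
  rw [← Finset.sum_boole]
  refine Finset.sum_le_sum fun i _ => ?_
  split_ifs with h
  exacts [h1 i h, h0 i]

theorem sum_le_card_filter {A : ℕ → Prop} [DecidablePred A] {s : Finset ℕ} {g : ℕ → ℝ}
    (h1 : ∀ i, g i ≤ 1) (h0 : ∀ i, ¬ A i → g i ≤ 0) : ∑ i ∈ s, g i ≤ ((s.filter A).card : ℝ) := by
  rw [← Finset.sum_boole]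
  refine Finset.sum_le_sum fun i _ => ?_
  split_ifs with h
  exacts [h1 i, h0 i h]

/-- The indicator of a true null. -/
def nullInd (b : Bool) : ℝ := if b = false then 1 else 0

theorem nullInd_mem (b : Bool) : nullInd b ∈ Set.Icc (0 : ℝ) 1 := by cases b <;> simp [nullInd]

theorem integral_nullInd_mul {Ω : Type*} [MeasurableSpace Ω] {P : Measure Ω} {H : ℕ → Ω → Bool}
    (hH : Measurable (H 0)) (f : Ω → ℝ) :
    ∫ ω, nullInd (H 0 ω) * f ω ∂P = ∫ ω in {ω | H 0 ω = false}, f ω ∂P := by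
  have hm : MeasurableSet {ω | H 0 ω = false} :=
    hH (measurableSet_singleton false)
  rw [← integral_indicator hm]
  refine integral_congr_ae (Eventually.of_forall fun ω => ?_)
  by_cases h : H 0 ω = false <;> simp [nullInd, h]

variable {Ω : Type*} [MeasurableSpace Ω] {P : Measure Ω} [IsProbabilityMeasure P] {p : ℕ}
  {γl γr α : ℝ} {H : ℕ → Ω → Bool} {Z : ℕ → Ω → ℝ} {X : ℕ → Ω → Fin p → ℝ}
  {K : Set (Param p)} {ξ₀ : Param p} {est : ℕ → Ω → Param p}

/-- The estimator takes values in `K`, up to a null set, and is strongly consistent for `ξ₀`. -/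
def ConsistentIn (P : Measure Ω) (K : Set (Param p)) (ξ₀ : Param p)
    (est : ℕ → Ω → Param p) : Prop :=
  IsCompact K ∧ ∃ (h₀ : ξ₀ ∈ K) (q : ℕ → Ω → K),
    (∀ᵐ ω ∂P, ∀ m, (q m ω : Param p) = est m ω) ∧
      ∀ᵐ ω ∂P, Tendsto (fun m => q m ω) atTop (𝓝 ⟨ξ₀, h₀⟩)

/-- The threshold serves as the second compact parameter of `uniform_law_at_estimate`, which gives
uniformity over `[0,1]` at the estimated parameter. The weight `κ` selects all hypotheses or only
the nulls. -/
theorem eventually_ramp_mean (hmodel : TwoGroupModel P H Z X)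
    (hcons : ConsistentIn P K ξ₀ est) {κ : Bool → ℝ} (hκ : ∀ b, κ b ∈ Set.Icc (0 : ℝ) 1)
    {f : ((Fin p → ℝ) × ℝ) × (Param p × ℝ) → ℝ} (hf : Continuous f) (ε : ℝ) :
    ∀ᵐ ω ∂P, ∀ η > 0, ∀ᶠ n : ℕ in atTop, ∀ t ∈ Set.Icc (0 : ℝ) 1,
      |(∑ i ∈ Finset.range n, κ (H i ω) * ramp ε (f ((X i ω, Z i ω), (est n ω, t)))) / n -
        ∫ ω', κ (H 0 ω') * ramp ε (f ((X 0 ω', Z 0 ω'), (ξ₀, t))) ∂P| < η := by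
  obtain ⟨hK, h₀, q, hq, hlim⟩ := hcons
  have : CompactSpace K := isCompact_iff_compactSpace.1 hK
  have hκc : Continuous κ := continuous_of_discreteTopology
  have hg : Continuous fun y : (Bool × ℝ × (Fin p → ℝ)) × (K × Set.Icc (0 : ℝ) 1) =>
      κ y.1.1 * ramp ε (f ((y.1.2.2, y.1.2.1), ((y.2.1 : Param p), (y.2.2 : ℝ)))) :=
    (hκc.comp (by fun_prop)).mul ((continuous_ramp ε).comp (hf.comp (by fun_prop)))
  have h := uniform_law_at_estimate (W := fun i ω => (H i ω, Z i ω, X i ω))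
    (fun i => (hmodel.measurable_H i).prodMk ((hmodel.measurable_Z i).prodMk
      (hmodel.measurable_X i))) hmodel.indep hmodel.identDistrib ⟨_, hg⟩ (C := 1)
    (fun y => by
      simp only [ContinuousMap.coe_mk]
      rw [abs_of_nonneg (mul_nonneg (hκ _).1 (ramp_nonneg _ _))]
      exact mul_le_one₀ (hκ _).2 (ramp_nonneg _ _) (ramp_le_one _ _)) hlim
  filter_upwards [h, hq] with ω hω hqω η hη
  filter_upwards [hω η hη] with n hn t ht
  have := hn ⟨t, ht⟩
  simp only [ContinuousMap.coe_mk, hqω] at this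
  exact this

theorem eventually_null_count_le (hmodel : TwoGroupModel P H Z X)
    (hcons : ConsistentIn P K ξ₀ est) (hγl : 2 < γl) (hγr : 2 < γr) {η : ℝ} (hη : 0 < η) :
    ∀ᵐ ω ∂P, ∀ᶠ n : ℕ in atTop, ∀ t ∈ Set.Icc (0 : ℝ) 1,
      (((Finset.range n).filter fun i =>
        assessor γl γr (est n ω) (X i ω) (uValue (Z i ω)) ≤ t ∧ H i ω = false).card : ℝ) ≤
      n * (nullMass P γl γr H X ξ₀ t + η) := by
  have huc := isCompact_Icc.uniformContinuousOn_of_continuous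
    (continuous_nullMass hmodel hγl hγr ξ₀).continuousOn (s := Set.Icc (0 : ℝ) 2)
  obtain ⟨δ, hδ, hD⟩ := Metric.uniformContinuousOn_iff.1 huc (η / 2) (half_pos hη)
  -- The bound `1` keeps `t + ε` in `[0,2]`; the bound `δ / 2` makes the shift by `ε` cost less than
  -- `η / 2`.
  have hε : 0 < min 1 (δ / 2) := lt_min one_pos (half_pos hδ)
  set ε := min 1 (δ / 2) with hεdef
  have hc : Continuous fun y : ((Fin p → ℝ) × ℝ) × (Param p × ℝ) =>
      y.2.2 + ε - assessor γl γr y.2.1 y.1.1 (uValue y.1.2) :=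
    (continuous_snd.snd.add continuous_const).sub (continuous_assessor_uValue hγl hγr
      continuous_snd.fst continuous_fst.fst continuous_fst.snd)
  filter_upwards [eventually_ramp_mean hmodel hcons nullInd_mem hc ε] with ω hω
  filter_upwards [hω (η / 2) (half_pos hη), eventually_gt_atTop 0] with n hn hn0 t ht
  have h1 := (abs_lt.1 (hn t ht)).2
  rw [integral_nullInd_mul (hmodel.measurable_H 0)] at h1
  have h2 := setIntegral_ramp_assessor_le hmodel hγl hγr ξ₀ hε t
  have h3 := hD (t + ε) ⟨by linarith [ht.1], by linarith [ht.2, min_le_left 1 (δ / 2)]⟩ t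
    ⟨ht.1, by linarith [ht.2]⟩ (by
      rw [Real.dist_eq, add_sub_cancel_left, abs_of_pos hε]
      linarith [min_le_right 1 (δ / 2)])
  rw [Real.dist_eq] at h3
  have h4 := (abs_lt.1 h3).2
  have hn' : (0 : ℝ) < n := Nat.cast_pos.2 hn0
  refine (card_filter_le_sum (g := fun i => nullInd (H i ω) *
    ramp ε (t + ε - assessor γl γr (est n ω) (X i ω) (uValue (Z i ω))))
    (fun i => mul_nonneg (nullInd_mem _).1 (ramp_nonneg _ _)) fun i hi => ?_).trans ?_
  · rw [ramp_of_le hε (by linarith [hi.1]), hi.2]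
    simp [nullInd]
  · rw [mul_comm, ← div_le_iff₀ hn']
    linarith

/-- Mirror statistics of the non-nulls are discarded, which only lowers the count; the nulls alone
contribute asymptotically at least `nullMass`. This makes the estimated proportion conservative. -/
theorem eventually_le_mirror_count (hmodel : TwoGroupModel P H Z X)
    (hcons : ConsistentIn P K ξ₀ est) (hγl : 2 < γl) (hγr : 2 < γr) {η : ℝ} (hη : 0 < η) :
    ∀ᵐ ω ∂P, ∀ᶠ n : ℕ in atTop, ∀ t ∈ Set.Icc (0 : ℝ) 1,
      n * (nullMass P γl γr H X ξ₀ t - η) ≤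
      (((Finset.range n).filter fun i =>
        mirror γl γr (est n ω) (X i ω) (uValue (Z i ω)) ≤ t).card : ℝ) := by
  have hε : 0 < η / 2 := half_pos hη
  have hc : Continuous fun y : ((Fin p → ℝ) × ℝ) × (Param p × ℝ) =>
      sStat γl γr y.2.1 y.1.1 (uValue y.1.2) - (1 - nullCDF γl γr y.2.1 y.1.1 y.2.2) :=
    (continuous_sStat_uValue hγl hγr continuous_snd.fst continuous_fst.fst
      continuous_fst.snd).sub (continuous_const.sub (continuous_nullCDF hγl hγr
        continuous_snd.fst continuous_fst.fst continuous_snd.snd))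
  filter_upwards [eventually_ramp_mean hmodel hcons nullInd_mem hc (η / 2)] with ω hω
  filter_upwards [hω (η / 2) hε, eventually_gt_atTop 0] with n hn hn0 t ht
  have h1 := (abs_lt.1 (hn t ht)).1
  rw [integral_nullInd_mul (hmodel.measurable_H 0)] at h1
  have h2 := le_setIntegral_ramp_sStat hmodel hγl hγr ξ₀ hε t
  have hn' : (0 : ℝ) < n := Nat.cast_pos.2 hn0
  refine le_trans ?_ (sum_le_card_filter (g := fun i => nullInd (H i ω) * ramp (η / 2)
    (sStat γl γr (est n ω) (X i ω) (uValue (Z i ω)) - (1 - nullCDF γl γr (est n ω) (X i ω) t)))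
    (fun i => mul_le_one₀ (nullInd_mem _).2 (ramp_nonneg _ _) (ramp_le_one _ _)) fun i hi => ?_)
  · rw [mul_comm, ← le_div_iff₀ hn']
    linarith
  · rw [mirror_le_iff hγl hγr _ _ ht, not_le] at hi
    rw [ramp_of_nonpos hε (by linarith), mul_zero]

/-- Needed at a single `t` only, to show that some threshold qualifies. The ramp is shifted by `ε`
to dominate the indicator, and `exists_measureReal_neg_le_lt` bounds the cost. -/
theorem eventually_mirror_count_le (hmodel : TwoGroupModel P H Z X)
    (hcons : ConsistentIn P K ξ₀ est) (hγl : 2 < γl) (hγr : 2 < γr) {G G₀ Gbar₀ : ℝ → ℝ}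
    (hlaws : StrongLaws P γl γr α H Z X ξ₀ G G₀ Gbar₀) {t : ℝ} (ht : t ∈ Set.Ioc (0 : ℝ) 1)
    {η : ℝ} (hη : 0 < η) :
    ∀ᵐ ω ∂P, ∀ᶠ n : ℕ in atTop,
      (((Finset.range n).filter fun i =>
        mirror γl γr (est n ω) (X i ω) (uValue (Z i ω)) ≤ t).card : ℝ) ≤ n * (Gbar₀ t + η) := by
  have ht' : t ∈ Set.Icc (0 : ℝ) 1 := ⟨ht.1.le, ht.2⟩
  have hf : Continuous fun y : Param p × (Fin p → ℝ) × ℝ =>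
      sStat γl γr y.1 y.2.1 (uValue y.2.2) - (1 - nullCDF γl γr y.1 y.2.1 t) :=
    (continuous_sStat_uValue hγl hγr continuous_fst continuous_snd.fst
      continuous_snd.snd).sub (continuous_const.sub (continuous_nullCDF hγl hγr
        continuous_fst continuous_snd.fst continuous_const))
  have hfw : Continuous fun w : Bool × ℝ × (Fin p → ℝ) =>
      sStat γl γr ξ₀ w.2.2 (uValue w.2.1) - (1 - nullCDF γl γr ξ₀ w.2.2 t) :=
    (continuous_sStat_uValue hγl hγr continuous_const continuous_snd.snd
      continuous_snd.fst).sub (continuous_const.sub (continuous_nullCDF hγl hγr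
        continuous_const continuous_snd.snd continuous_const))
  have hW : ∀ i, Measurable fun ω => (H i ω, Z i ω, X i ω) := fun i =>
    (hmodel.measurable_H i).prodMk ((hmodel.measurable_Z i).prodMk (hmodel.measurable_X i))
  have hfW : Measurable fun ω => sStat γl γr ξ₀ (X 0 ω) (uValue (Z 0 ω)) -
      (1 - nullCDF γl γr ξ₀ (X 0 ω) t) :=
    measurable_comp_triple hf measurable_const hmodel.measurable_X hmodel.measurable_Z 0
  -- The abstract limit is identified with a probability by comparing two almost sure limits of the
  -- same frequencies.
  have hGbar : Gbar₀ t = P.real {ω | 0 ≤ sStat γl γr ξ₀ (X 0 ω) (uValue (Z 0 ω)) -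
      (1 - nullCDF γl γr ξ₀ (X 0 ω) t)} := by
    have h := strong_law_frequency (A := fun w : Bool × ℝ × (Fin p → ℝ) =>
      1 - nullCDF γl γr ξ₀ w.2.2 t ≤ sStat γl γr ξ₀ w.2.2 (uValue w.2.1)) hW hmodel.indep
      hmodel.identDistrib (by
        have := measurableSet_le (measurable_const (a := (0 : ℝ))) hfw.measurable
        simpa only [sub_nonneg] using this)
    obtain ⟨ω, h1, h2⟩ := (h.and (hlaws.tendsto_mirror t ht)).exists
    simp only [sub_nonneg]
    exact tendsto_nhds_unique h2 h1
  obtain ⟨ε, hε, hεP⟩ := exists_measureReal_neg_le_lt (μ := P) hfW (half_pos hη)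
  have hc : Continuous fun y : ((Fin p → ℝ) × ℝ) × (Param p × ℝ) =>
      ε + (sStat γl γr y.2.1 y.1.1 (uValue y.1.2) - (1 - nullCDF γl γr y.2.1 y.1.1 y.2.2)) :=
    continuous_const.add ((continuous_sStat_uValue hγl hγr continuous_snd.fst continuous_fst.fst
      continuous_fst.snd).sub (continuous_const.sub (continuous_nullCDF hγl hγr
        continuous_snd.fst continuous_fst.fst continuous_snd.snd)))
  filter_upwards [eventually_ramp_mean hmodel hcons (κ := fun _ => 1) (by simp) hc ε] with ω hω
  filter_upwards [hω (η / 2) (half_pos hη), eventually_gt_atTop 0] with n hn hn0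
  have h1 := (abs_lt.1 (hn t ht')).2
  simp only [one_mul] at h1
  have h2 := integral_ramp_le (μ := P) hε (hfW.const_add ε)
  simp only [← neg_le_iff_add_nonneg'] at h2
  have hn' : (0 : ℝ) < n := Nat.cast_pos.2 hn0
  refine (card_filter_le_sum (g := fun i => ramp ε (ε +
    (sStat γl γr (est n ω) (X i ω) (uValue (Z i ω)) - (1 - nullCDF γl γr (est n ω) (X i ω) t))))
    (fun i => ramp_nonneg _ _) fun i hi => ?_).trans ?_
  · rw [mirror_le_iff hγl hγr _ _ ht'] at hi
    rw [ramp_of_le hε (by linarith)]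
  · rw [mul_comm, ← div_le_iff₀ hn']
    linarith

/-- Continuity of `G` supplies `s < t` with `G s` close to `G t`. The ramp of width `t - s` equals
`1` when `T ≤ s` and `0` when `T > t`. -/
theorem eventually_le_assessor_count (hmodel : TwoGroupModel P H Z X)
    (hcons : ConsistentIn P K ξ₀ est) (hγl : 2 < γl) (hγr : 2 < γr) {G G₀ Gbar₀ : ℝ → ℝ}
    (hlaws : StrongLaws P γl γr α H Z X ξ₀ G G₀ Gbar₀) {t : ℝ} (ht : t ∈ Set.Ioc (0 : ℝ) 1)
    {η : ℝ} (hη : 0 < η) :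
    ∀ᵐ ω ∂P, ∀ᶠ n : ℕ in atTop, n * (G t - η) ≤
      (((Finset.range n).filter fun i =>
        assessor γl γr (est n ω) (X i ω) (uValue (Z i ω)) ≤ t).card : ℝ) := by
  have ht' : t ∈ Set.Icc (0 : ℝ) 1 := ⟨ht.1.le, ht.2⟩
  obtain ⟨s, hs, hst, hGs⟩ : ∃ s ∈ Set.Ioc (0 : ℝ) 1, s < t ∧ G t - η / 2 < G s := by
    have h1 : ContinuousWithinAt G (Set.Iio t) t :=
      (hlaws.continuousOn_G t ht).mono_of_mem_nhdsWithin (by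
        filter_upwards [Ioo_mem_nhdsLT ht.1] with s hs using ⟨hs.1, hs.2.le.trans ht.2⟩)
    have h2 := (h1.eventually_const_lt (sub_lt_self _ (half_pos hη))).and
      (Ioo_mem_nhdsLT ht.1)
    obtain ⟨s, hs1, hs2⟩ := h2.exists
    exact ⟨s, ⟨hs2.1, hs2.2.le.trans ht.2⟩, hs2.2, hs1⟩
  have hW : ∀ i, Measurable fun ω => (H i ω, Z i ω, X i ω) := fun i =>
    (hmodel.measurable_H i).prodMk ((hmodel.measurable_Z i).prodMk (hmodel.measurable_X i))
  have hf : Continuous fun w : Bool × ℝ × (Fin p → ℝ) => assessor γl γr ξ₀ w.2.2 (uValue w.2.1) :=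
    continuous_assessor_uValue hγl hγr continuous_const continuous_snd.snd continuous_snd.fst
  have hfW : Measurable fun ω => assessor γl γr ξ₀ (X 0 ω) (uValue (Z 0 ω)) :=
    measurable_assessor hγl hγr measurable_const hmodel.measurable_X hmodel.measurable_Z 0
  have hG : G s = P.real {ω | assessor γl γr ξ₀ (X 0 ω) (uValue (Z 0 ω)) ≤ s} := by
    have h := strong_law_frequency (A := fun w : Bool × ℝ × (Fin p → ℝ) =>
      assessor γl γr ξ₀ w.2.2 (uValue w.2.1) ≤ s) hW hmodel.indep
      hmodel.identDistrib (measurableSet_le hf.measurable measurable_const)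
    obtain ⟨ω, h1, h2⟩ := (h.and (hlaws.tendsto_all s hs)).exists
    exact tendsto_nhds_unique h2 h1
  have hε : 0 < t - s := sub_pos.2 hst
  have hc : Continuous fun y : ((Fin p → ℝ) × ℝ) × (Param p × ℝ) =>
      y.2.2 - assessor γl γr y.2.1 y.1.1 (uValue y.1.2) :=
    continuous_snd.snd.sub (continuous_assessor_uValue hγl hγr
      continuous_snd.fst continuous_fst.fst continuous_fst.snd)
  filter_upwards [eventually_ramp_mean hmodel hcons (κ := fun _ => 1) (by simp) hc (t - s)]
    with ω hω
  filter_upwards [hω (η / 2) (half_pos hη), eventually_gt_atTop 0] with n hn hn0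
  have h1 := (abs_lt.1 (hn t ht')).1
  simp only [one_mul] at h1
  have h2 := le_integral_ramp (μ := P) hε (hfW.const_sub t)
  simp only [sub_le_sub_iff_left] at h2
  have hn' : (0 : ℝ) < n := Nat.cast_pos.2 hn0
  refine le_trans ?_ (sum_le_card_filter (g := fun i => ramp (t - s)
    (t - assessor γl γr (est n ω) (X i ω) (uValue (Z i ω))))
    (fun i => ramp_le_one _ _) fun i hi => ?_)
  · rw [mul_comm, ← le_div_iff₀ hn']
    linarith
  · rw [ramp_of_nonpos hε (by linarith [not_le.1 hi])]

end Frequencies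

/-! ## The false discovery proportion at the data-driven threshold -/

section FDP

variable {p : ℕ} {γl γr α : ℝ}

/-- If the mirror statistics dominate the number of false discoveries up to `η`, uniformly in the
threshold, then the false discovery proportion exceeds the level by at most a multiple of `η`. -/
theorem fdp_rejected_le {D : ℝ → ℝ} (hD : Continuous D) (hα : 0 ≤ α) {η c t₀ : ℝ} (hη : 0 < η)
    (hc : 0 < c) (ht₀ : t₀ ∈ Set.Ioc (0 : ℝ) 1) {ξ : Param p} {x : ℕ → Fin p → ℝ} {u : ℕ → ℝ}
    {h : ℕ → Bool} {n : ℕ} (hn : 0 < n)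
    (hV : ∀ t ∈ Set.Icc (0 : ℝ) 1, (((Finset.range n).filter fun i =>
      assessor γl γr ξ (x i) (u i) ≤ t ∧ h i = false).card : ℝ) ≤ n * (D t + η))
    (hM : ∀ t ∈ Set.Icc (0 : ℝ) 1, n * (D t - η) ≤ (((Finset.range n).filter fun i =>
      mirror γl γr ξ (x i) (u i) ≤ t).card : ℝ))
    (hN : n * c ≤ (((Finset.range n).filter fun i =>
      assessor γl γr ξ (x i) (u i) ≤ t₀).card : ℝ))
    (hF : fdpHat γl γr ξ x u n t₀ ≤ α) :
    fdp h (rejected γl γr α ξ x u n) ≤ α + 3 * η / c := by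
  have hne : {t : ℝ | t ∈ Set.Icc (0 : ℝ) 1 ∧ fdpHat γl γr ξ x u n t ≤ α}.Nonempty :=
    ⟨t₀, ⟨ht₀.1.le, ht₀.2⟩, hF⟩
  have hbdd := bddAbove_fdpHat_le (γl := γl) (γr := γr) α ξ x u n
  have ht₀τ : t₀ ≤ threshold γl γr α ξ x u n := le_csSup hbdd ⟨⟨ht₀.1.le, ht₀.2⟩, hF⟩
  have hτ1 : threshold γl γr α ξ x u n ≤ 1 := csSup_le hne fun t ht => ht.1.2
  -- The supremum need not be attained, so the estimated proportion is evaluated at a qualifying `s`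
  -- just below the threshold; continuity of `D` absorbs the difference.
  have hDτ := Metric.continuousAt_iff.1 (hD.continuousAt (x := threshold γl γr α ξ x u n)) η hη
  obtain ⟨δ, hδ, hDδ⟩ := hDτ
  obtain ⟨s, ⟨hs01, hsα⟩, hs⟩ := exists_lt_of_lt_csSup hne
    (show threshold γl γr α ξ x u n - δ < _ from sub_lt_self _ hδ)
  have hsτ : s ≤ threshold γl γr α ξ x u n := le_csSup hbdd ⟨hs01, hsα⟩
  have hDs := hDδ (x := s) (by
    rw [Real.dist_eq, abs_sub_comm, abs_of_nonneg (sub_nonneg.2 hsτ)]; linarith)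
  rw [Real.dist_eq] at hDs
  have hDs' := (abs_lt.1 hDs).1
  have hn' : (0 : ℝ) < n := Nat.cast_pos.2 hn
  unfold fdpHat at hsα
  rw [div_le_iff₀ (by positivity)] at hsα
  unfold fdp
  have hle : ∀ t ≤ threshold γl γr α ξ x u n, ((Finset.range n).filter fun i =>
      assessor γl γr ξ (x i) (u i) ≤ t).card ≤ (rejected γl γr α ξ x u n).card := fun t ht =>
    Finset.card_le_card (Finset.monotone_filter_right _ fun i _ hi => hi.trans ht)
  have hR1 : ((max ((Finset.range n).filter fun i =>
      assessor γl γr ξ (x i) (u i) ≤ s).card 1 : ℕ) : ℝ) ≤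
      (max (rejected γl γr α ξ x u n).card 1 : ℕ) := by
    exact_mod_cast max_le_max_right 1 (hle s hsτ)
  have hR2 : n * c ≤ ((max (rejected γl γr α ξ x u n).card 1 : ℕ) : ℝ) :=
    hN.trans (by exact_mod_cast (hle t₀ ht₀τ).trans (le_max_left _ _))
  have hVτ := hV _ ⟨ht₀.1.le.trans ht₀τ, hτ1⟩
  have hMs := hM s hs01
  rw [div_le_iff₀ (by positivity)]
  have hfil : (rejected γl γr α ξ x u n).filter (fun i => h i = false) =
      (Finset.range n).filter fun i =>
        assessor γl γr ξ (x i) (u i) ≤ threshold γl γr α ξ x u n ∧ h i = false :=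
    Finset.filter_filter _ _ _
  rw [hfil]
  -- With `τ` the threshold, `V` and `R` the counts of false and of all rejections, and `M` the
  -- mirror count: `V ≤ n(D(τ) + η) ≤ n(D(s) + 2η) ≤ M(s) + 3nη ≤ α(R ∨ 1) + 3nη`. The last term is
  -- at most `(3η/c)(R ∨ 1)` because `R ≥ nc`.
  have k1 := mul_le_mul_of_nonneg_left hR1 hα
  have k2 : 3 * η / c * (n * c) ≤
      3 * η / c * ((max (rejected γl γr α ξ x u n).card 1 : ℕ) : ℝ) :=
    mul_le_mul_of_nonneg_left hR2 (by positivity)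
  have k3 : 3 * η / c * (n * c) = 3 * (n * η) := by field_simp
  have k4 := mul_le_mul_of_nonneg_left hDs'.le hn'.le
  rw [add_mul]
  linarith

variable {Ω : Type*} [MeasurableSpace Ω] {P : Measure Ω} [IsProbabilityMeasure P]
  {H : ℕ → Ω → Bool} {Z : ℕ → Ω → ℝ} {X : ℕ → Ω → Fin p → ℝ}
  {K : Set (Param p)} {ξ₀ : Param p} {est : ℕ → Ω → Param p}

theorem eventually_zapFDP_le (hmodel : TwoGroupModel P H Z X)
    (hcons : ConsistentIn P K ξ₀ est) (hα : 0 ≤ α) (hγl : 2 < γl) (hγr : 2 < γr)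
    {G G₀ Gbar₀ : ℝ → ℝ} (hlaws : StrongLaws P γl γr α H Z X ξ₀ G G₀ Gbar₀) {η : ℝ}
    (hη : 0 < η) :
    ∀ᵐ ω ∂P, ∀ᶠ n : ℕ in atTop, zapFDP γl γr α H Z X est n ω ≤ α + η := by
  obtain ⟨t₀, ht₀, hlt⟩ := hlaws.exists_lt
  have hG := (hlaws.pos t₀ ht₀).1
  rw [div_lt_iff₀ hG] at hlt
  -- One `e` absorbs the sampling error of the mirror count, the other the `1` in the numerator of
  -- the estimated proportion, once `n ≥ 1/e`.
  obtain ⟨e, he, heG, heα⟩ : ∃ e > 0, e ≤ G t₀ / 2 ∧ Gbar₀ t₀ + 2 * e ≤ α * (G t₀ - e) := by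
    have hpos : 0 < (α * G t₀ - Gbar₀ t₀) / (2 + α) :=
      div_pos (sub_pos.2 hlt) (by linarith)
    refine ⟨min (G t₀ / 2) ((α * G t₀ - Gbar₀ t₀) / (2 + α)), lt_min (half_pos hG) hpos,
      min_le_left _ _, ?_⟩
    have := min_le_right (G t₀ / 2) ((α * G t₀ - Gbar₀ t₀) / (2 + α))
    rw [le_div_iff₀ (by linarith)] at this
    linarith
  -- Chosen so that the excess `3η'/c` with `c = G t₀ / 2` equals `η`.
  have hη' : 0 < η * (G t₀ / 2) / 3 := by positivity
  filter_upwards [eventually_null_count_le hmodel hcons hγl hγr hη',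
    eventually_le_mirror_count hmodel hcons hγl hγr hη',
    eventually_mirror_count_le hmodel hcons hγl hγr hlaws ht₀ he,
    eventually_le_assessor_count hmodel hcons hγl hγr hlaws ht₀ he] with ω h1 h2 h3 h4
  filter_upwards [h1, h2, h3, h4, eventually_gt_atTop 0,
    tendsto_natCast_atTop_atTop.eventually_ge_atTop (1 / e)] with n h1 h2 h3 h4 hn hne
  have hn' : (0 : ℝ) < n := Nat.cast_pos.2 hn
  rw [div_le_iff₀ he] at hne
  have hN : n * (G t₀ / 2) ≤ n * (G t₀ - e) :=
    mul_le_mul_of_nonneg_left (by linarith) hn'.le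
  have h := fdp_rejected_le (h := fun i => H i ω)
    (continuous_nullMass hmodel hγl hγr ξ₀) hα hη' (half_pos hG) ht₀ hn h1 h2
    (hN.trans h4) (by
      unfold fdpHat
      rw [div_le_iff₀ (by positivity)]
      have k1 := mul_le_mul_of_nonneg_left heα hn'.le
      have k2 := mul_le_mul_of_nonneg_left (h4.trans (Nat.cast_le.2 (le_max_left _ 1))) hα
      linarith)
  refine h.trans_eq ?_
  field_simp

/-- An almost sure asymptotic bound for a bounded sequence bounds its means asymptotically. -/
theorem limsup_integral_le {f : ℕ → Ω → ℝ} (hf : ∀ n, Measurable (f n))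
    (h0 : ∀ n ω, 0 ≤ f n ω) (h1 : ∀ n ω, f n ω ≤ 1) {a : ℝ}
    (ha : ∀ η > 0, ∀ᵐ ω ∂P, ∀ᶠ n in atTop, f n ω ≤ a + η) :
    limsup (fun n => ∫ ω, f n ω ∂P) atTop ≤ a := by
  have hint : ∀ n, Integrable (f n) P := fun n =>
    (integrable_const (1 : ℝ)).mono' (hf n).aestronglyMeasurable
      (Eventually.of_forall fun ω => by
        rw [Real.norm_eq_abs, abs_of_nonneg (h0 n ω)]; exact h1 n ω)
  refine le_of_forall_pos_le_add fun η hη => ?_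
  have hbelow : ∀ n, 0 ≤ ∫ ω, f n ω ∂P := fun n => integral_nonneg (h0 n)
  have hmax : ∀ n, Integrable (fun ω => max (f n ω - (a + η / 2)) 0) P := fun n =>
    ((hint n).sub (integrable_const _)).sup (integrable_const 0)
  -- The positive part of the excess is bounded and, almost surely, eventually zero, so its mean
  -- vanishes in the limit.
  have hlim : Tendsto (fun n => ∫ ω, max (f n ω - (a + η / 2)) 0 ∂P) atTop (𝓝 0) := by
    have h := tendsto_integral_of_dominated_convergence (μ := P)
      (F := fun n ω => max (f n ω - (a + η / 2)) 0) (f := fun _ => (0 : ℝ))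
      (fun _ => 1 + |a + η / 2|) (fun n => (hmax n).aestronglyMeasurable) (integrable_const _)
      (fun n => Eventually.of_forall fun ω => by
        rw [Real.norm_eq_abs, abs_of_nonneg (le_max_right _ _)]
        exact max_le (by linarith [h1 n ω, neg_abs_le (a + η / 2)]) (by positivity))
      (by
        filter_upwards [ha (η / 2) (half_pos hη)] with ω hω
        refine tendsto_const_nhds.congr' ?_
        filter_upwards [hω] with n hn
        exact (max_eq_right (sub_nonpos.2 hn)).symm)
    simpa using h
  refine limsup_le_of_le (isCoboundedUnder_le_of_le atTop hbelow) ?_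
  filter_upwards [hlim.eventually_lt_const (half_pos hη)] with n hn
  have : ∫ ω, f n ω ∂P ≤ ∫ ω, (a + η / 2 + max (f n ω - (a + η / 2)) 0) ∂P :=
    integral_mono (hint n) ((integrable_const _).add (hmax n)) fun ω => by
      have := le_max_left (f n ω - (a + η / 2)) 0
      linarith
  rw [integral_add (integrable_const _) (hmax n)] at this
  simp only [integral_const, probReal_univ, smul_eq_mul, one_mul] at this
  linarith

end FDP

end ZAP

end

theorem theorem1 {Ω : Type*} [MeasurableSpace Ω] (P : Measure Ω) [IsProbabilityMeasure P]
    {p : ℕ} (H : ℕ → Ω → Bool) (Z : ℕ → Ω → ℝ) (X : ℕ → Ω → Fin p → ℝ)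
    (hmodel : ZAP.TwoGroupModel P H Z X)
    (α : ℝ) (hα : α ∈ Set.Ioo (0 : ℝ) 1)
    (γl γr : ℝ) (hγl : 2 < γl) (hγr : 2 < γr)
    (Θ B : Set (ZAP.Coef p × ZAP.Coef p)) (ξstar : ZAP.Param p)
    (hmax : ZAP.UniqueMaximizer P γl γr Z X Θ B ξstar)
    (hreg : ZAP.Regularity P Z X)
    (G G₀ Gbar₀ : ℝ → ℝ)
    (hlaws : ZAP.StrongLaws P γl γr α H Z X ξstar G G₀ Gbar₀)
    (est : ℕ → Ω → ZAP.Param p) (hest : ZAP.IsMLE P γl γr Z X Θ B est) :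
    (∀ m, Integrable (ZAP.zapFDP γl γr α H Z X est m) P) ∧
      limsup (fun m : ℕ => ∫ ω, ZAP.zapFDP γl γr α H Z X est m ω ∂P) atTop ≤ α := by
  have hmeas : ∀ m, Measurable (ZAP.zapFDP γl γr α H Z X est m) := fun m =>
    ZAP.measurable_zapFDP hγl hγr α hmodel.measurable_H hmodel.measurable_X hmodel.measurable_Z
      (hest.measurable m)
  have h0 : ∀ m ω, 0 ≤ ZAP.zapFDP γl γr α H Z X est m ω := fun m ω => ZAP.fdp_nonneg _ _
  have h1 : ∀ m ω, ZAP.zapFDP γl γr α H Z X est m ω ≤ 1 := fun m ω => ZAP.fdp_le_one _ _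
  have hcons : ZAP.ConsistentIn P (Θ ×ˢ B) ξstar est :=
    ⟨hmax.compact_theta.prod hmax.compact_beta, hmax.mem,
      ZAP.exists_tendsto_eq_est hmodel hγl hγr hmax hreg hest⟩
  refine ⟨fun m => (integrable_const (1 : ℝ)).mono' (hmeas m).aestronglyMeasurable
    (Eventually.of_forall fun ω => ?_), ZAP.limsup_integral_le hmeas h0 h1 fun η hη =>
      ZAP.eventually_zapFDP_le hmodel hcons hα.1.le hγl hγr hlaws hη⟩
  rw [Real.norm_eq_abs, abs_of_nonneg (h0 m ω)]
  exact h1 m ω
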